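/- Let $\mathbb X$ be a complex Banach space, $A$ a (possibly unbounded) linear operator in $\mathbb X$ with domain $D(A)$, $0<\alpha\le 1$, and $f\in BUC(\mathbb R^+,\mathbb X)$, the space of bounded uniformly continuous functions $[0,\infty)\to\mathbb X$ with the sup-norm. Let $C_0(\mathbb R^+,\mathbb X)$ be the subspace of functions tending to $0$ at infinity, $\mathbb Y:=BUC(\mathbb R^+,\mathbb X)/C_0(\mathbb R^+,\mathbb X)$ with the quotient norm, and let $\tilde g\in\mathbb Y$ denote the class of $g$. Let $\mathcal D=d/dt$ in $BUC(\mathbb R^+,\mathbb X)$ with domain $\{g: g' \text{ exists and } g'\in BUC(\mathbb R^+,\mathbb X)\}$, and let $\tilde{\mathcal D}$ be the (single-valued) operator in $\mathbb Y$ with domain $\{\tilde u: u\in D(\mathcal D)\}$ and $\tilde{\mathcal D}\tilde u=\widetilde{\mathcal Du}$. The spectrum $sp(g)\subset\mathbb R$ of $g\in BUC(\mathbb R^+,\mathbb X)$ is the set of all $\xi\in\mathbb R$ such that $\lambda\mapsto(\lambda-\tilde{\mathcal D})^{-1}\tilde g$, defined on the resolvent set of $\tilde{\mathcal D}$, has no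 analytic extension to any neighbourhood of $i\xi$. Put $\lambda^\alpha=|\lambda|^\alpha e^{i\alpha\arg\lambda}$ with $-\pi<\arg\lambda<\pi$, and $0^\alpha=0$. Let $\rho(A,\alpha)$ be the set of those $\xi$ for which $\xi^\alpha-A$ has a bounded everywhere defined inverse and, for some open neighbourhood $U$ of $\xi$, the inverse $(\lambda^\alpha-A)^{-1}$ exists and is analytic in $\lambda\in U\setminus(-\infty,0]$. Put $\Sigma_i(A,\alpha)=i\mathbb R\setminus\rho(A,\alpha)$. With $J^\alpha v(t)=\frac1{\Gamma(\alpha)}\int_0^t(t-\tau)^{\alpha-1}v(\tau)\,d\tau$, a function $u\in BUC(\mathbb R^+,\mathbb X)$ is called an asymptotic mild solution of the Caputo fractional equation $D^\alpha_Cu(t)=Au(t)+f(t)$, $t\ge0$, if there is $\epsilon\in C_0(\mathbb R^+,\mathbb X)$ such that for every $t\ge 0$ one has $J^\alpha u(t)\in D(A)$ and $$u(t)=AJ^\alpha u(t)+J^\alpha(f+\epsilon)(t)+u(0).$$ (i) If $\Sigma_i(A,\alpha)\subset 2\pi i\mathbb Z$ and $sp(f)\subset2\pi\mathbb Z$, then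 every asymptotic mild solution $u$ of this equation is asymptotic $1$-periodic, i.e. $\lim_{t\to\infty}(u(t+1)-u(t))=0$. (ii) If $\Sigma_i(A,\alpha)\subset(2\mathbb Z+1)\pi i$ and $sp(f)\subset(2\mathbb Z+1)\pi$, then every asymptotic mild solution $u$ of this equation is asymptotic anti-$1$-periodic, i.e. $\lim_{t\to\infty}(u(t+1)+u(t))=0$. -/

import Mathlib

open scoped NNReal Topology
open Filter

noncomputable section

namespace FracAsymp

universe u

/-! ### Function spaces on the half line `[0, ∞)` (modelled by `ℝ≥0`) -/

/-- The bounded uniformly continuous functions `[0, ∞) → X`, as a subspace of the space of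
bounded continuous functions (with the sup norm). -/
def bucSubmodule (X : Type u) [NormedAddCommGroup X] [NormedSpace ℂ X] :
    Submodule ℂ (BoundedContinuousFunction ℝ≥0 X) where
  carrier := {f | UniformContinuous f}
  zero_mem' := by
    have h : UniformContinuous (fun _ : ℝ≥0 => (0 : X)) := uniformContinuous_const
    exact h
  add_mem' := by
    intro f g hf hg
    have h : UniformContinuous (fun t => f t + g t) := UniformContinuous.add hf hg
    exact h
  smul_mem' := by
    intro c f hf
    have h : UniformContinuous (fun t => c • f t) := UniformContinuous.const_smul hf c
    exact h

/-- `BUC(ℝ⁺, X)` with the sup norm. -/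
abbrev BUC (X : Type u) [NormedAddCommGroup X] [NormedSpace ℂ X] : Type u :=
  ↥(bucSubmodule X)

section

variable {X : Type u} [NormedAddCommGroup X] [NormedSpace ℂ X]

instance : CoeFun (BUC X) (fun _ => ℝ≥0 → X) := ⟨fun f => f.1⟩

variable (X) in
/-- `C₀(ℝ⁺, X)`: the functions in `BUC(ℝ⁺, X)` that tend to `0` at infinity. -/
def C0 : Submodule ℂ (BUC X) where
  carrier := {f | Tendsto (fun t => f t) atTop (𝓝 0)}
  zero_mem' := by
    have h : Tendsto (fun _ : ℝ≥0 => (0 : X)) atTop (𝓝 0) := tendsto_const_nhds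
    exact h
  add_mem' := by
    intro f g hf hg
    have h : Tendsto (fun t => f t + g t) atTop (𝓝 (0 + 0)) := Tendsto.add hf hg
    rw [add_zero] at h
    exact h
  smul_mem' := by
    intro c f hf
    have h : Tendsto (fun t => c • f t) atTop (𝓝 (c • (0 : X))) := Tendsto.const_smul hf c
    rw [smul_zero] at h
    exact h

theorem mem_C0 (f : BUC X) : f ∈ C0 X ↔ Tendsto (fun t => f t) atTop (𝓝 0) := Iff.rfl

instance isClosed_C0 : IsClosed ((C0 X : Submodule ℂ (BUC X)) : Set (BUC X)) := by
  refine isClosed_of_closure_subset fun f hf => ?_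
  rw [SetLike.mem_coe, mem_C0, Metric.tendsto_atTop]
  intro ε hε
  obtain ⟨g, hg, hfg⟩ := Metric.mem_closure_iff.1 hf (ε / 2) (half_pos hε)
  rw [SetLike.mem_coe, mem_C0, Metric.tendsto_atTop] at hg
  obtain ⟨N, hN⟩ := hg (ε / 2) (half_pos hε)
  refine ⟨N, fun n hn => ?_⟩
  have h1 : dist (f n) (g n) ≤ dist f g := BoundedContinuousFunction.dist_coe_le_dist n
  have h2 := hN n hn
  have h3 := dist_triangle (f n) (g n) 0
  linarith

variable (X) in
/-- The quotient Banach space `Y = BUC(ℝ⁺, X) / C₀(ℝ⁺, X)` with the quotient norm. -/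
def Y : Type u := BUC X ⧸ C0 X

instance : NormedAddCommGroup (Y X) :=
  inferInstanceAs (NormedAddCommGroup (BUC X ⧸ C0 X))

instance : NormedSpace ℂ (Y X) :=
  inferInstanceAs (NormedSpace ℂ (BUC X ⧸ C0 X))

variable (X) in
/-- The quotient map, sending `f ∈ BUC(ℝ⁺, X)` to its class `f̃ ∈ Y`. -/
def cls : BUC X →ₗ[ℂ] Y X := (C0 X).mkQ

theorem cls_eq_zero_iff (f : BUC X) : cls X f = 0 ↔ f ∈ C0 X :=
  Submodule.Quotient.mk_eq_zero (C0 X)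

/-! ### The differentiation operator and the operator it induces on the quotient -/

/-- `g` is the derivative of `f` on `[0, ∞)` (one-sided at `0`). -/
def IsDeriv (f g : BUC X) : Prop :=
  ∀ t : ℝ≥0, HasDerivWithinAt (fun s : ℝ => f s.toNNReal) (g t) (Set.Ici 0) (t : ℝ)

variable (X) in
/-- The graph of `𝒟 = d/dt` in `BUC(ℝ⁺, X)`, whose domain consists of the differentiable
functions in `BUC` with derivative in `BUC`. -/
def derivGraph : Submodule ℂ (BUC X × BUC X) where
  carrier := {p | IsDeriv p.1 p.2}
  zero_mem' := fun t => hasDerivWithinAt_const (t : ℝ) _ (0 : X)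
  add_mem' := fun {_ _} hp hq t => (hp t).add (hq t)
  smul_mem' := fun c _ hp t => (hp t).const_smul c

theorem mem_derivGraph (p : BUC X × BUC X) : p ∈ derivGraph X ↔ IsDeriv p.1 p.2 := Iff.rfl

variable (X) in
/-- The graph of `𝒟̃`: the pairs of classes `(ũ, (𝒟u)~)` with `u ∈ D(𝒟)`. -/
def derivTildeGraph : Submodule ℂ (Y X × Y X) :=
  (derivGraph X).map (LinearMap.prodMap (cls X) (cls X))

/-- If `u ∈ C₀` has a derivative `g ∈ BUC`, then `g ∈ C₀`. -/
theorem IsDeriv.mem_C0 {u g : BUC X} (h : IsDeriv u g) (hu : u ∈ C0 X) : g ∈ C0 X := by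
  rw [FracAsymp.mem_C0, Metric.tendsto_atTop] at hu ⊢
  intro ε hε
  have huc : UniformContinuous (fun t => g t) := g.2
  obtain ⟨δ, hδ, hgδ⟩ := Metric.uniformContinuous_iff.1 huc (ε / 2) (half_pos hε)
  obtain ⟨N, hN⟩ := hu (δ / 2 * (ε / 4)) (by positivity)
  refine ⟨N, fun n hn => ?_⟩
  set d : ℝ := δ / 2 with hd
  have hd0 : 0 < d := by positivity
  have hn0 : (0 : ℝ) ≤ n := n.2
  have key := (convex_Icc (n : ℝ) (n + d)).norm_image_sub_le_of_norm_hasDerivWithin_le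
    (f := fun s : ℝ => u s.toNNReal - s • g n)
    (f' := fun s : ℝ => g s.toNNReal - (1 : ℝ) • g n) (C := ε / 2)
    (x := (n : ℝ)) (y := n + d)
    (by
      intro s hs
      have hs0 : 0 ≤ s := hn0.trans hs.1
      have h1 := h s.toNNReal
      rw [Real.coe_toNNReal s hs0] at h1
      exact (h1.mono (fun r hr => hn0.trans hr.1)).sub
        ((hasDerivWithinAt_id s _).smul_const (g n)))
    (by
      intro s hs
      have hs0 : 0 ≤ s := hn0.trans hs.1
      have h2 : dist s.toNNReal n < δ := by
        rw [NNReal.dist_eq, Real.coe_toNNReal s hs0, abs_of_nonneg (by linarith [hs.1])]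
        have := hs.2
        linarith
      have h3 := hgδ h2
      rw [dist_eq_norm] at h3
      rw [one_smul]
      exact h3.le)
    ⟨le_refl _, by linarith⟩ ⟨by linarith, le_refl _⟩
  have e1 : (n : ℝ) + d - n = d := by ring
  rw [e1, Real.norm_eq_abs, abs_of_pos hd0] at key
  have hA : ‖u ((n : ℝ) + d).toNNReal‖ < d * (ε / 4) := by
    have hle : N ≤ ((n : ℝ) + d).toNNReal := by
      refine hn.trans ?_
      rw [← NNReal.coe_le_coe, Real.coe_toNNReal _ (by linarith)]
      linarith
    simpa [dist_eq_norm] using hN _ hle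
  have hB : ‖u (n : ℝ).toNNReal‖ < d * (ε / 4) := by
    rw [Real.toNNReal_coe]
    simpa [dist_eq_norm] using hN n hn
  have e2 : d • g n = (u ((n : ℝ) + d).toNNReal - u (n : ℝ).toNNReal)
      - ((u ((n : ℝ) + d).toNNReal - ((n : ℝ) + d) • g n)
        - (u (n : ℝ).toNNReal - (n : ℝ) • g n)) := by
    rw [add_smul]; abel
  have h4 : d * ‖g n‖ < d * ε := by
    calc d * ‖g n‖ = ‖d • g n‖ := by rw [norm_smul, Real.norm_eq_abs, abs_of_pos hd0]
      _ ≤ ‖u ((n : ℝ) + d).toNNReal - u (n : ℝ).toNNReal‖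
          + ‖(u ((n : ℝ) + d).toNNReal - ((n : ℝ) + d) • g n)
              - (u (n : ℝ).toNNReal - (n : ℝ) • g n)‖ := by
            rw [e2]; exact norm_sub_le _ _
      _ ≤ (‖u ((n : ℝ) + d).toNNReal‖ + ‖u (n : ℝ).toNNReal‖) + ε / 2 * d := by
            exact add_le_add (norm_sub_le _ _) key
      _ < d * ε := by linarith
  rw [dist_zero_right]
  exact lt_of_mul_lt_mul_left h4 hd0.le

/-- `𝒟̃` is single valued. -/
theorem derivTildeGraph_functional (p : Y X × Y X) (hp : p ∈ derivTildeGraph X)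
    (h0 : p.1 = 0) : p.2 = 0 := by
  obtain ⟨⟨u, g⟩, hug, rfl⟩ := hp
  have hu : u ∈ C0 X := (cls_eq_zero_iff u).1 h0
  exact (cls_eq_zero_iff g).2 (IsDeriv.mem_C0 hug hu)

variable (X) in
/-- The operator `𝒟̃` in `Y`, with domain `{ũ : u ∈ D(𝒟)}` and `𝒟̃ũ = (𝒟u)~`; by
`derivTildeGraph_functional` its graph is `derivTildeGraph X`. -/
def derivTilde : Y X →ₗ.[ℂ] Y X := (derivTildeGraph X).toLinearPMap

theorem derivTilde_graph : (derivTilde X).graph = derivTildeGraph X :=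
  Submodule.toLinearPMap_graph_eq _ derivTildeGraph_functional

end

/-! ### Inverses of `z - T` for unbounded operators -/

/-- `R` is the bounded, everywhere defined inverse `(z - T)⁻¹` of the (possibly unbounded)
operator `T`. Such an `R` is unique. -/
def IsResolvent {E : Type u} [NormedAddCommGroup E] [NormedSpace ℂ E]
    (T : E →ₗ.[ℂ] E) (z : ℂ) (R : E →L[ℂ] E) : Prop :=
  (∀ x : E, ∃ h : R x ∈ T.domain, z • R x - T ⟨R x, h⟩ = x) ∧
    ∀ y : T.domain, R (z • (y : E) - T y) = (y : E)

theorem IsResolvent.unique {E : Type u} [NormedAddCommGroup E] [NormedSpace ℂ E]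
    {T : E →ₗ.[ℂ] E} {z : ℂ} {R R' : E →L[ℂ] E}
    (h : IsResolvent T z R) (h' : IsResolvent T z R') : R = R' := by
  ext x
  obtain ⟨hx, e⟩ := h'.1 x
  have := h.2 ⟨R' x, hx⟩
  rwa [e] at this

section

variable {X : Type u} [NormedAddCommGroup X] [NormedSpace ℂ X]

/-! ### The spectrum of a function on the half line -/

/-- The function `f̂(z) = (z - 𝒟̃)⁻¹ f̃`, defined on the resolvent set of `𝒟̃`, has an analytic
extension to some neighbourhood of the point `z₀`. -/
def HasAnalyticExtensionAt (f : BUC X) (z₀ : ℂ) : Prop :=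
  ∃ U : Set ℂ, IsOpen U ∧ z₀ ∈ U ∧ ∃ G : ℂ → Y X, AnalyticOnNhd ℂ G U ∧
    ∀ z ∈ U, ∀ R : Y X →L[ℂ] Y X, IsResolvent (derivTilde X) z R → G z = R (cls X f)

/-- The spectrum `sp(f) ⊆ ℝ` of `f ∈ BUC(ℝ⁺, X)`. -/
def sp (f : BUC X) : Set ℝ :=
  {ξ : ℝ | ¬ HasAnalyticExtensionAt f (Complex.I * ξ)}

/-! ### The sets `ρ(A, α)` and `Σᵢ(A, α)` -/

/-- `ρ(A, α)`: the `ξ` for which `ξ ^ α - A` has a bounded inverse and `z ↦ (z ^ α - A)⁻¹` exists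
and is analytic near `ξ`, on the slit plane `-π < arg z < π` in which the (principal) power
is an analytic function. For `ξ ≠ 0` on the imaginary axis this is a full neighbourhood
of `ξ`; at `ξ = 0` one has `0 ^ α = 0`. -/
def fracResolventSet (A : X →ₗ.[ℂ] X) (α : ℝ) : Set ℂ :=
  {ξ : ℂ | ∃ U : Set ℂ, IsOpen U ∧ ξ ∈ U ∧ ∃ R : ℂ → (X →L[ℂ] X),
    IsResolvent A (ξ ^ (α : ℂ)) (R ξ) ∧
    (∀ z ∈ U ∩ Complex.slitPlane, IsResolvent A (z ^ (α : ℂ)) (R z)) ∧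
    AnalyticOnNhd ℂ R (U ∩ Complex.slitPlane)}

/-- `Σᵢ(A, α) = iℝ \ ρ(A, α)`. -/
def SigmaI (A : X →ₗ.[ℂ] X) (α : ℝ) : Set ℂ :=
  Set.range (fun ξ : ℝ => Complex.I * (ξ : ℂ)) \ fracResolventSet A α

/-! ### Mild solutions -/

/-- The kernel `g_α(t) = t ^ (α - 1) / Γ(α)`. -/
def gker (α t : ℝ) : ℝ := t ^ (α - 1) / Real.Gamma α

/-- The Riemann–Liouville integral `J^α u (t) = ∫₀ᵗ g_α(t - τ) u(τ) dτ`. -/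
def fracInt (α : ℝ) (u : ℝ≥0 → X) (t : ℝ≥0) : X :=
  ∫ τ in (0 : ℝ)..(t : ℝ), gker α ((t : ℝ) - τ) • u τ.toNNReal

/-- `u` is a mild solution on `ℝ⁺` of `D_C^α u(t) = A u(t) + h(t)`: it is continuous and, for
every `t ≥ 0`, `J^α u(t) ∈ D(A)` and `u(t) = A J^α u(t) + J^α h(t) + u(0)`. -/
def IsMildSolution (A : X →ₗ.[ℂ] X) (α : ℝ) (h u : ℝ≥0 → X) : Prop :=
  Continuous u ∧ ∀ t : ℝ≥0, ∃ hmem : fracInt α u t ∈ A.domain,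
    u t = A ⟨fracInt α u t, hmem⟩ + fracInt α h t + u 0

/-- `u ∈ BUC` is an asymptotic mild solution of `D_C^α u(t) = A u(t) + f(t)`: for some
`ε ∈ C₀` it is a mild solution of `D_C^α u(t) = A u(t) + f(t) + ε(t)`. -/
def IsAsymptoticMildSolution (A : X →ₗ.[ℂ] X) (α : ℝ) (f u : BUC X) : Prop :=
  ∃ ε ∈ C0 X, IsMildSolution A α (fun t => f t + ε t) (fun t => u t)

/-! ### Asymptotic periodicity -/

/-- `g` is asymptotic Bloch `1`-periodic of type `p`. -/
def IsAsymptoticBloch (p : ℝ) (g : BUC X) : Prop :=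
  Tendsto (fun t : ℝ≥0 => g (t + 1) - Complex.exp (Complex.I * p) • g t) atTop (𝓝 0)

/-- `g` is asymptotic `1`-periodic: `g(t + 1) - g(t) → 0`. -/
def IsAsymptoticPeriodic (g : BUC X) : Prop := IsAsymptoticBloch 0 g

/-- `g` is asymptotic anti `1`-periodic: `g(t + 1) + g(t) → 0`. -/
def IsAsymptoticAntiPeriodic (g : BUC X) : Prop := IsAsymptoticBloch Real.pi g

end

end FracAsymp

end

namespace FracAsymp

open Set MeasureTheory Complex

/-! ### Stieltjes transforms and the constant in Balakrishnan's formula -/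

/-! The proof studies the local resolvent `û(z) = (z - 𝒟̃)⁻¹ ũ` in the quotient `Y`. It is
holomorphic off the imaginary axis with norm at most `‖ũ‖ / |re z|` (`isResolvent_resY`,
`norm_resY_le`), and the perturbation `ε` of the equation vanishes in `Y`.

The equation becomes an algebraic formula for `û`. Put `x = u(0)` and let `R` be the inverse of `z ^
α - A`; the mild equation reads `J^α u = R (z ^ α J^α u - (u - x) + J^α (f + ε))`. In Laplace
symbols, `J^α` is `s ^ (-α)` and convolution with `e ^ (z t)` is `1 / (s - z)`, and `s ^ α / (s - z)
= (s ^ α - z ^ α) / (s - z) + z ^ α / (s - z)`. The first summand is the symbol of a bounded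
convolution operator on `BUC`, given explicitly by Balakrishnan's integral and analytic in `z` on
the slit plane. Applying the sum to the equation (`fracKer_rlInt`, `expConv_eq_of_mild`) and passing
to `Y`, where multiples of `e ^ (z t)` disappear, gives `û(z) = R (f̂(z) + K(z) (u - x) + z ^ (α -
1) x)`; this is `resY_eq_of_mild`.

Hence `û` extends analytically across every `iξ`, `ξ ≠ 0`, with `iξ ∈ ρ(A, α)` and `ξ ∉ sp(f)`. The
point `0` lies on the edge of the slit and needs its own argument: when it is an isolated
singularity, the resolvent bound makes `z û(z)` extend analytically to `0`, and the formula forces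
`x û(x) → 0` as `x ↓ 0`, so `û` itself extends (`extendsAt_zero_of_mild`).

Both parts of the theorem say that the remaining singularities satisfy `e ^ z = c`, with `c = 1` or
`c = -1`. Let `S` be translation by `1` and `y = (S - c) ũ`. Since `S û - e ^ z û` is locally
bounded, the local resolvent of `y` is `O(|e ^ z - c| / |re z|) + O(1)`, that is `O(|z - z₀| / |re
z|)` near a point `z₀` of the axis with `e ^ z₀ = c`. A Levinson-type maximum principle makes such
isolated singularities removable (`ExtendsAt.of_isolated`). The local resolvent of `y` is then
entire and bounded by `‖y‖ / |re z|`, so it vanishes by a Liouville argument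
(`eq_zero_of_extendsAt`). Thus `y = 0`, which is the claim. -/

theorem integrableOn_rpow_div_one_add {α : ℝ} (h0 : 0 < α) (h1 : α < 1) :
    IntegrableOn (fun x : ℝ => x ^ (α - 1) / (1 + x)) (Ioi 0) := by
  have hmeas : Measurable (fun x : ℝ => x ^ (α - 1) / (1 + x)) := by fun_prop
  rw [← Ioc_union_Ioi_eq_Ioi zero_le_one]
  refine IntegrableOn.union ?_ ?_
  · have h : IntegrableOn (fun x : ℝ => x ^ (α - 1)) (Ioc 0 1) :=
      (intervalIntegrable_iff_integrableOn_Ioc_of_le zero_le_one).1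
        (intervalIntegral.intervalIntegrable_rpow' (by linarith))
    refine h.mono' hmeas.aestronglyMeasurable ?_
    refine (ae_restrict_mem measurableSet_Ioc).mono fun x hx => ?_
    have hx0 := hx.1
    rw [Real.norm_of_nonneg (by positivity)]
    exact div_le_self (by positivity) (by linarith)
  · have h : IntegrableOn (fun x : ℝ => x ^ (α - 2)) (Ioi 1) :=
      integrableOn_Ioi_rpow_of_lt (by linarith) zero_lt_one
    refine h.mono' hmeas.aestronglyMeasurable ?_
    refine (ae_restrict_mem measurableSet_Ioi).mono fun x hx => ?_
    have hx0 : 0 < x := zero_lt_one.trans hx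
    rw [Real.norm_of_nonneg (by positivity), show α - 2 = α - 1 - 1 by ring,
      Real.rpow_sub_one hx0.ne' (α - 1)]
    gcongr
    linarith

/-- A locally uniform lower bound, linear in `x`: it yields both convergence of Stieltjes integrals
and differentiation under the integral sign. -/
theorem exists_mul_one_add_le_norm_add {z₀ : ℂ} (hz : z₀ ∈ slitPlane) :
    ∃ δ > 0, ∀ z ∈ Metric.ball z₀ δ, ∀ x : ℝ, 0 ≤ x → δ * (1 + x) ≤ ‖(x : ℂ) + z‖ := by
  obtain ⟨m, hm, hmx⟩ : ∃ m > 0, ∀ x : ℝ, 0 ≤ x → m ≤ ‖(x : ℂ) + z₀‖ := by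
    rcases hz with h | h
    · refine ⟨z₀.re, h, fun x hx => ?_⟩
      have := Complex.re_le_norm ((x : ℂ) + z₀)
      simp only [add_re, ofReal_re] at this
      linarith
    · refine ⟨|z₀.im|, abs_pos.2 h, fun x hx => ?_⟩
      have := Complex.abs_im_le_norm ((x : ℂ) + z₀)
      simpa using this
  set N : ℝ := ‖z₀‖ with hN
  have hN0 : 0 ≤ N := norm_nonneg _
  set δ : ℝ := min (1 / 4) (m / (4 * N + 4)) with hδ
  have hδ0 : 0 < δ := by positivity
  refine ⟨δ, hδ0, fun z hzb x hx => ?_⟩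
  have h2 : 2 * δ * (1 + x) ≤ ‖(x : ℂ) + z₀‖ := by
    -- For large `x`, `x - N ≥ (1 + x) / 2`, which explains the `1 / 4`; for the other `x`, `1 + x <
    -- 2 * N + 2`, and the distance `m` from `-z₀` to the half line decides.
    by_cases hxN : 2 * N + 1 ≤ x
    · have h3 : x - N ≤ ‖(x : ℂ) + z₀‖ := by
        have := norm_sub_le_norm_add (x : ℂ) z₀
        rwa [Complex.norm_of_nonneg hx] at this
      have h4 : δ ≤ 1 / 4 := min_le_left _ _
      nlinarith
    · have h4 : δ * (4 * N + 4) ≤ m := by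
        have : δ ≤ m / (4 * N + 4) := min_le_right _ _
        rwa [le_div_iff₀ (by positivity)] at this
      push Not at hxN
      refine le_trans ?_ (hmx x hx)
      nlinarith
  have h5 : ‖(x : ℂ) + z₀‖ - ‖z - z₀‖ ≤ ‖(x : ℂ) + z‖ := by
    have := norm_sub_le_norm_add ((x : ℂ) + z₀) (z - z₀)
    rwa [show (x : ℂ) + z₀ + (z - z₀) = x + z by ring] at this
  have h6 : ‖z - z₀‖ < δ := by rwa [Metric.mem_ball, dist_eq_norm] at hzb
  nlinarith

section

variable {E : Type*} [NormedAddCommGroup E] [NormedSpace ℂ E]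

theorem integrableOn_stieltjes {α C : ℝ} (h0 : 0 < α) (h1 : α < 1) {φ : ℝ → E}
    (hφm : AEStronglyMeasurable φ (volume.restrict (Ioi 0)))
    (hφ : ∀ x, 0 < x → ‖φ x‖ ≤ C * x ^ (α - 1)) {z : ℂ} (hz : z ∈ slitPlane) :
    IntegrableOn (fun x : ℝ => ((x : ℂ) + z)⁻¹ • φ x) (Ioi 0) := by
  obtain ⟨δ, hδ, hb⟩ := exists_mul_one_add_le_norm_add hz
  have hb := hb z (Metric.mem_ball_self hδ)
  refine ((integrableOn_rpow_div_one_add h0 h1).const_mul (C / δ)).mono' ?_ ?_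
  · have : Measurable fun x : ℝ => ((x : ℂ) + z)⁻¹ := by fun_prop
    exact this.aestronglyMeasurable.smul hφm
  · refine (ae_restrict_mem measurableSet_Ioi).mono fun x hx => ?_
    have hx : (0 : ℝ) < x := hx
    rw [norm_smul, norm_inv]
    have h2 : ‖(x : ℂ) + z‖⁻¹ ≤ (δ * (1 + x))⁻¹ := inv_anti₀ (by positivity) (hb x hx.le)
    calc _ ≤ (δ * (1 + x))⁻¹ * (C * x ^ (α - 1)) :=
          mul_le_mul h2 (hφ x hx) (norm_nonneg _) (by positivity)
      _ = _ := by field_simp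

theorem analyticOnNhd_stieltjes [CompleteSpace E] {α C : ℝ} (h0 : 0 < α) (h1 : α < 1)
    {φ : ℝ → E} (hφm : AEStronglyMeasurable φ (volume.restrict (Ioi 0)))
    (hφ : ∀ x, 0 < x → ‖φ x‖ ≤ C * x ^ (α - 1)) :
    AnalyticOnNhd ℂ (fun z : ℂ => ∫ x in Ioi (0 : ℝ), ((x : ℂ) + z)⁻¹ • φ x) slitPlane := by
  refine DifferentiableOn.analyticOnNhd (fun z₀ hz₀ => ?_) isOpen_slitPlane
  refine DifferentiableAt.differentiableWithinAt ?_
  obtain ⟨δ, hδ, hb⟩ := exists_mul_one_add_le_norm_add hz₀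
  have hF := hasDerivAt_integral_of_dominated_loc_of_deriv_le (μ := volume.restrict (Ioi (0 : ℝ)))
    (F := fun (z : ℂ) (x : ℝ) => ((x : ℂ) + z)⁻¹ • φ x)
    (F' := fun (z : ℂ) (x : ℝ) => (-(((x : ℂ) + z) ^ 2)⁻¹) • φ x)
    (bound := fun x => C / δ ^ 2 * (x ^ (α - 1) / (1 + x)))
    (x₀ := z₀) (Metric.ball_mem_nhds z₀ hδ) ?_ (integrableOn_stieltjes h0 h1 hφm hφ hz₀) ?_ ?_
    ((integrableOn_rpow_div_one_add h0 h1).const_mul _) ?_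
  · exact hF.2.differentiableAt
  · refine Eventually.of_forall fun z => ?_
    have : Measurable fun x : ℝ => ((x : ℂ) + z)⁻¹ := by fun_prop
    exact this.aestronglyMeasurable.smul hφm
  · have : Measurable fun x : ℝ => (-(((x : ℂ) + z₀) ^ 2)⁻¹) := by fun_prop
    exact this.aestronglyMeasurable.smul hφm
  · refine (ae_restrict_mem measurableSet_Ioi).mono fun x hx z hz => ?_
    have hx : (0 : ℝ) < x := hx
    rw [norm_smul, norm_neg, norm_inv, norm_pow]
    have h2 : (‖(x : ℂ) + z‖ ^ 2)⁻¹ ≤ (δ ^ 2 * (1 + x))⁻¹ := by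
      refine inv_anti₀ (by positivity) ?_
      calc δ ^ 2 * (1 + x) ≤ δ ^ 2 * ((1 + x) * (1 + x)) := by
            gcongr; nlinarith
        _ = (δ * (1 + x)) ^ 2 := by ring
        _ ≤ _ := by gcongr; exact hb z hz x hx.le
    calc _ ≤ (δ ^ 2 * (1 + x))⁻¹ * (C * x ^ (α - 1)) :=
          mul_le_mul h2 (hφ x hx) (norm_nonneg _) (by positivity)
      _ = _ := by field_simp
  · refine (ae_restrict_mem measurableSet_Ioi).mono fun x hx z hz => ?_
    have hx : (0 : ℝ) < x := hx
    have hne : (x : ℂ) + z ≠ 0 := norm_pos_iff.1 (lt_of_lt_of_le (by positivity) (hb z hz x hx.le))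
    have h3 : HasDerivAt (fun z : ℂ => ((x : ℂ) + z)⁻¹) (-1 / ((x : ℂ) + z) ^ 2) z :=
      ((hasDerivAt_id z).const_add (x : ℂ)).inv hne
    have h4 := h3.smul_const (φ x)
    convert h4 using 2
    rw [neg_div, one_div]

end

/-- Write `1 / (x + r)` as the integral of `e ^ (-(x + r) s)` over `s > 0` and swap: the
`x`-integral gives `Γ(α) s ^ (-α)`, the `s`-integral then `Γ(1 - α) r ^ (α - 1)`. -/
theorem integral_rpow_div_add {α r : ℝ} (h0 : 0 < α) (h1 : α < 1) (hr : 0 < r) :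
    ∫ x in Ioi (0 : ℝ), x ^ (α - 1) / (x + r)
      = Real.Gamma α * Real.Gamma (1 - α) * r ^ (α - 1) := by
  have e1 : ∀ s ∈ Ioi (0 : ℝ), ∫ x in Ioi (0 : ℝ), x ^ (α - 1) * Real.exp (-((x + r) * s))
      = Real.Gamma α * (s ^ ((1 - α) - 1) * Real.exp (-(r * s))) := by
    intro s hs
    have hs : 0 < s := hs
    have h2 := Real.integral_rpow_mul_exp_neg_mul_Ioi h0 hs
    have : ∀ x : ℝ, x ^ (α - 1) * Real.exp (-((x + r) * s))
        = x ^ (α - 1) * Real.exp (-(s * x)) * Real.exp (-(r * s)) := by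
      intro x
      rw [mul_assoc, ← Real.exp_add]
      ring_nf
    simp_rw [this]
    rw [integral_mul_const, h2, one_div, Real.inv_rpow hs.le, ← Real.rpow_neg hs.le]
    ring_nf
  have e2 : ∀ x ∈ Ioi (0 : ℝ), ∫ s in Ioi (0 : ℝ), x ^ (α - 1) * Real.exp (-((x + r) * s))
      = x ^ (α - 1) / (x + r) := by
    intro x hx
    have hx : 0 < x := hx
    have h2 := Real.integral_rpow_mul_exp_neg_mul_Ioi (a := 1) one_pos (add_pos hx hr)
    simp only [sub_self, Real.rpow_zero, one_mul, Real.rpow_one, Real.Gamma_one, mul_one] at h2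
    rw [integral_const_mul, h2, mul_one_div]
  have hG : IntegrableOn (fun s : ℝ => s ^ ((1 - α) - 1) * Real.exp (-(r * s))) (Ioi 0) := by
    -- A non-integrable function has integral `0` by convention, so a nonzero value of the integral
    -- proves integrability.
    refine Integrable.of_integral_ne_zero ?_
    rw [Real.integral_rpow_mul_exp_neg_mul_Ioi (by linarith) hr]
    have : 0 < 1 - α := by linarith
    positivity
  have hGx : ∀ s ∈ Ioi (0 : ℝ),
      IntegrableOn (fun x : ℝ => x ^ (α - 1) * Real.exp (-((x + r) * s))) (Ioi 0) := by
    intro s hs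
    refine Integrable.of_integral_ne_zero ?_
    rw [e1 s hs]
    have hs : 0 < s := hs
    have : 0 < 1 - α := by linarith
    positivity
  have hint : Integrable (fun p : ℝ × ℝ => p.1 ^ (α - 1) * Real.exp (-((p.1 + r) * p.2)))
      ((volume.restrict (Ioi 0)).prod (volume.restrict (Ioi 0))) := by
    rw [integrable_prod_iff' (by
      have : Measurable (fun p : ℝ × ℝ => p.1 ^ (α - 1) * Real.exp (-((p.1 + r) * p.2))) := by
        fun_prop
      exact this.aestronglyMeasurable)]
    refine ⟨(ae_restrict_mem measurableSet_Ioi).mono hGx, ?_⟩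
    refine (hG.const_mul (Real.Gamma α)).congr ?_
    refine (ae_restrict_mem measurableSet_Ioi).mono fun s hs => ?_
    refine (e1 s hs).symm.trans ?_
    refine setIntegral_congr_fun measurableSet_Ioi fun x hx => ?_
    have hx : 0 < x := hx
    simp only
    rw [Real.norm_of_nonneg (by positivity)]
  calc _ = ∫ x in Ioi (0 : ℝ), ∫ s in Ioi (0 : ℝ), x ^ (α - 1) * Real.exp (-((x + r) * s)) :=
        (setIntegral_congr_fun measurableSet_Ioi e2).symm
    _ = ∫ s in Ioi (0 : ℝ), ∫ x in Ioi (0 : ℝ), x ^ (α - 1) * Real.exp (-((x + r) * s)) :=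
        integral_integral_swap hint
    _ = ∫ s in Ioi (0 : ℝ), Real.Gamma α * (s ^ ((1 - α) - 1) * Real.exp (-(r * s))) :=
        setIntegral_congr_fun measurableSet_Ioi e1
    _ = _ := by
        rw [integral_const_mul, Real.integral_rpow_mul_exp_neg_mul_Ioi (by linarith) hr, one_div,
          Real.inv_rpow hr.le, ← Real.rpow_neg hr.le]
        ring_nf

/-- The constant `1 / (Γ(α) Γ(1 - α))` of Balakrishnan's formula. -/
noncomputable def balakrishnanConst (α : ℝ) : ℝ := (Real.Gamma α * Real.Gamma (1 - α))⁻¹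

theorem balakrishnanConst_pos {α : ℝ} (h0 : 0 < α) (h1 : α < 1) : 0 < balakrishnanConst α := by
  have : 0 < 1 - α := by linarith
  unfold balakrishnanConst
  positivity

/-- Both sides are analytic on the connected slit plane and agree on the positive reals, which
accumulate at `1`. -/
theorem integral_rpow_mul_inv_add {α : ℝ} (h0 : 0 < α) (h1 : α < 1) {z : ℂ}
    (hz : z ∈ slitPlane) :
    ∫ x in Ioi (0 : ℝ), ((x : ℂ) + z)⁻¹ • ((x ^ (α - 1) : ℝ) : ℂ)
      = ((balakrishnanConst α)⁻¹ : ℝ) * z ^ ((α : ℂ) - 1) := by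
  have hA : AnalyticOnNhd ℂ (fun z : ℂ => ∫ x in Ioi (0 : ℝ),
      ((x : ℂ) + z)⁻¹ • ((x ^ (α - 1) : ℝ) : ℂ)) slitPlane := by
    refine analyticOnNhd_stieltjes (C := 1) h0 h1 ?_ ?_
    · have : Measurable fun x : ℝ => ((x ^ (α - 1) : ℝ) : ℂ) := by fun_prop
      exact this.aestronglyMeasurable
    · intro x hx
      rw [norm_real, Real.norm_of_nonneg (by positivity), one_mul]
  have hB : AnalyticOnNhd ℂ (fun z : ℂ => ((balakrishnanConst α)⁻¹ : ℝ) * z ^ ((α : ℂ) - 1))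
      slitPlane := by
    refine DifferentiableOn.analyticOnNhd (fun w hw => ?_) isOpen_slitPlane
    exact ((differentiableAt_id.cpow_const hw).const_mul _).differentiableWithinAt
  refine hA.eqOn_of_preconnected_of_frequently_eq hB
    (starConvex_one_slitPlane.isPathConnected one_mem_slitPlane).isConnected.isPreconnected
    one_mem_slitPlane ?_ hz
  have hreal : ∀ r : ℝ, 0 < r → ∫ x in Ioi (0 : ℝ), ((x : ℂ) + (r : ℂ))⁻¹ • ((x ^ (α - 1) : ℝ) : ℂ)
      = ((balakrishnanConst α)⁻¹ : ℝ) * (r : ℂ) ^ ((α : ℂ) - 1) := by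
    intro r hr
    have h3 := integral_rpow_div_add h0 h1 hr
    have h4 : ∀ x : ℝ, ((x : ℂ) + (r : ℂ))⁻¹ • ((x ^ (α - 1) : ℝ) : ℂ)
        = ((x ^ (α - 1) / (x + r) : ℝ) : ℂ) := by
      intro x
      push_cast
      rw [smul_eq_mul, div_eq_inv_mul]
    simp_rw [h4]
    rw [integral_complex_ofReal, h3, balakrishnanConst, inv_inv]
    push_cast
    rw [ofReal_cpow hr.le]
    push_cast
    rfl
  have ht : Tendsto (fun n : ℕ => ((1 + 1 / ((n : ℝ) + 1) : ℝ) : ℂ)) atTop (𝓝[≠] 1) := by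
    refine tendsto_nhdsWithin_iff.2 ⟨?_, Eventually.of_forall fun n => ?_⟩
    · have := (tendsto_one_div_add_atTop_nhds_zero_nat (𝕜 := ℝ)).const_add 1
      rw [add_zero] at this
      exact (continuous_ofReal.tendsto' _ _ (by simp)).comp this
    · have : (0 : ℝ) < 1 / ((n : ℝ) + 1) := by positivity
      intro hh
      rw [mem_singleton_iff, ofReal_eq_one] at hh
      linarith
  exact ht.frequently (Frequently.of_forall fun n => hreal _ (by positivity))

/-! ### The beta integral -/

/-- The exponents add up to `-1`, so rescaling leaves no power of `t - r` and only the beta value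
`B(α, 1 - α)` remains. -/
theorem integral_sub_rpow_mul_sub_rpow {α : ℝ} (h0 : 0 < α) (h1 : α < 1) {r t : ℝ} (h : r < t) :
    ∫ s in r..t, (t - s) ^ (-α) * (s - r) ^ (α - 1) = (balakrishnanConst α)⁻¹ := by
  have ha : 0 < t - r := by linarith
  have hb := betaIntegral_scaled (α : ℂ) (1 - α : ℂ) ha
  have hg := Gamma_mul_Gamma_eq_betaIntegral (s := (α : ℂ)) (t := 1 - α) (by simpa)
    (by simpa using h1)
  rw [show (α : ℂ) + (1 - α) = 1 by ring, Gamma_one, one_mul] at hg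
  rw [show (α : ℂ) + (1 - α) - 1 = 0 by ring, cpow_zero, one_mul, ← hg] at hb
  have hs := intervalIntegral.integral_comp_sub_right (a := r) (b := t)
    (fun x : ℝ => (t - r - x) ^ (-α) * x ^ (α - 1)) r
  rw [sub_self] at hs
  have e1 : ∀ s : ℝ, (t - s) ^ (-α) * (s - r) ^ (α - 1)
      = (t - r - (s - r)) ^ (-α) * (s - r) ^ (α - 1) := by
    intro s; congr 2; ring
  simp_rw [e1]
  rw [hs, balakrishnanConst, inv_inv]
  have h3 : ((∫ x in (0 : ℝ)..(t - r), (t - r - x) ^ (-α) * x ^ (α - 1) : ℝ) : ℂ)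
      = Gamma (α : ℂ) * Gamma (1 - α : ℂ) := by
    rw [← hb, ← intervalIntegral.integral_ofReal]
    refine intervalIntegral.integral_congr fun x hx => ?_
    rw [uIcc_of_le ha.le] at hx
    push_cast
    rw [ofReal_cpow (by linarith [hx.2] : (0 : ℝ) ≤ t - r - x), ofReal_cpow hx.1]
    push_cast
    rw [mul_comm]
    congr 2
    ring
  rw [show (1 - α : ℂ) = ((1 - α : ℝ) : ℂ) by push_cast; rfl, Gamma_ofReal, Gamma_ofReal] at h3
  exact_mod_cast h3

section

variable {X : Type*} [NormedAddCommGroup X] [NormedSpace ℂ X]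

/-! ### Convolution with exponentials -/

/-- `∫₀ᵗ e ^ (z (t - s)) φ(s) ds`. -/
noncomputable def expConv (z : ℂ) (φ : ℝ → X) (t : ℝ) : X :=
  ∫ s in (0 : ℝ)..t, cexp (z * (t - s)) • φ s

theorem expConv_eq_smul (z : ℂ) (φ : ℝ → X) (t : ℝ) :
    expConv z φ t = cexp (z * t) • ∫ s in (0 : ℝ)..t, cexp (-(z * s)) • φ s := by
  rw [expConv, ← intervalIntegral.integral_smul]
  congr 1
  ext s
  rw [smul_smul, ← Complex.exp_add]
  ring_nf

@[simp]
theorem expConv_zero (z : ℂ) (φ : ℝ → X) : expConv z φ 0 = 0 := by simp [expConv]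

theorem expConv_congr {z : ℂ} {φ ψ : ℝ → X} {t : ℝ} (ht : 0 ≤ t)
    (h : ∀ s ∈ Icc 0 t, φ s = ψ s) : expConv z φ t = expConv z ψ t := by
  refine intervalIntegral.integral_congr fun s hs => ?_
  rw [uIcc_of_le ht] at hs
  simp only [h s hs]

theorem expConv_add (z : ℂ) {φ ψ : ℝ → X} (hφ : Continuous φ) (hψ : Continuous ψ) (t : ℝ) :
    expConv z (fun s => φ s + ψ s) t = expConv z φ t + expConv z ψ t := by
  simp only [expConv, smul_add]
  exact intervalIntegral.integral_add (Continuous.intervalIntegrable (by fun_prop) _ _)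
    (Continuous.intervalIntegrable (by fun_prop) _ _)

theorem expConv_sub (z : ℂ) {φ ψ : ℝ → X} (hφ : Continuous φ) (hψ : Continuous ψ) (t : ℝ) :
    expConv z (fun s => φ s - ψ s) t = expConv z φ t - expConv z ψ t := by
  simp only [expConv, smul_sub]
  exact intervalIntegral.integral_sub (Continuous.intervalIntegrable (by fun_prop) _ _)
    (Continuous.intervalIntegrable (by fun_prop) _ _)

theorem expConv_smul (z c : ℂ) (φ : ℝ → X) (t : ℝ) :
    expConv z (fun s => c • φ s) t = c • expConv z φ t := by
  simp only [expConv, smul_comm _ c]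
  exact intervalIntegral.integral_smul _ _

theorem expConv_clm [CompleteSpace X] (T : X →L[ℂ] X) (z : ℂ) {φ : ℝ → X} (hφ : Continuous φ)
    (t : ℝ) : expConv z (fun s => T (φ s)) t = T (expConv z φ t) := by
  simp only [expConv, ← map_smul]
  exact T.intervalIntegral_comp_comm (Continuous.intervalIntegrable (by fun_prop) _ _)

theorem continuous_uncurry_expConv_neg {φ : ℝ → X} (hφ : Continuous φ) :
    Continuous fun p : ℝ × ℝ => expConv (-(p.1 : ℂ)) φ p.2 := by
  unfold expConv
  refine intervalIntegral.continuous_parametric_intervalIntegral_of_continuous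
    (f := fun (p : ℝ × ℝ) s => cexp (-(p.1 : ℂ) * (p.2 - s)) • φ s) ?_ continuous_snd
  fun_prop

theorem integral_exp_mul_sub {a : ℝ} (ha : a ≠ 0) (t : ℝ) :
    ∫ s in (0 : ℝ)..t, Real.exp (a * (t - s)) = (Real.exp (a * t) - 1) / a := by
  have h : ∀ s : ℝ, HasDerivAt (fun s => -(Real.exp (a * (t - s)) / a)) (Real.exp (a * (t - s))) s := by
    intro s
    have := ((((hasDerivAt_id s).const_sub t).const_mul a).exp.div_const a).neg
    refine this.congr_deriv ?_
    simp only [id]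
    field_simp
  rw [intervalIntegral.integral_eq_sub_of_hasDerivAt (fun s _ => h s)
    (Continuous.intervalIntegrable (by fun_prop) _ _)]
  simp
  ring

theorem norm_expConv_le {z : ℂ} {φ : ℝ → X} {M t : ℝ} (ht : 0 ≤ t)
    (hM : ∀ s ∈ Icc 0 t, ‖φ s‖ ≤ M) :
    ‖expConv z φ t‖ ≤ ∫ s in (0 : ℝ)..t, M * Real.exp (z.re * (t - s)) := by
  refine intervalIntegral.norm_integral_le_of_norm_le ht
    (Eventually.of_forall fun s hs => ?_) (Continuous.intervalIntegrable (by fun_prop) _ _)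
  rw [norm_smul, Complex.norm_exp, mul_comm]
  have : (z * ((t : ℂ) - s)).re = z.re * (t - s) := by
    rw [← ofReal_sub, re_mul_ofReal]
  rw [this]
  gcongr
  exact hM s ⟨hs.1.le, hs.2⟩

theorem norm_expConv_le_div {z : ℂ} (hz : z.re < 0) {φ : ℝ → X} {M t : ℝ} (ht : 0 ≤ t)
    (hM : ∀ s ∈ Icc 0 t, ‖φ s‖ ≤ M) : ‖expConv z φ t‖ ≤ M / (-z.re) := by
  have hM0 : 0 ≤ M := (norm_nonneg _).trans (hM 0 ⟨le_rfl, ht⟩)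
  refine (norm_expConv_le ht hM).trans ?_
  rw [intervalIntegral.integral_const_mul, integral_exp_mul_sub hz.ne, div_eq_mul_inv M]
  refine mul_le_mul_of_nonneg_left ?_ hM0
  rw [← neg_div_neg_eq, div_eq_mul_inv]
  have : 0 < (-z.re)⁻¹ := inv_pos.2 (by linarith)
  have h2 := Real.exp_pos (z.re * t)
  nlinarith

/-- Adding the bounds `M / x`, good at infinity, and `M * t`, good at `0`, produces a majorant that
remains integrable against `x ^ (α - 1)`. -/
theorem norm_expConv_neg_le {φ : ℝ → X} {M t x : ℝ} (ht : 0 ≤ t) (hx : 0 < x)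
    (hM : ∀ s ∈ Icc 0 t, ‖φ s‖ ≤ M) :
    ‖expConv (-(x : ℂ)) φ t‖ ≤ M * (1 + t) / (1 + x) := by
  have hM0 : 0 ≤ M := (norm_nonneg _).trans (hM 0 ⟨le_rfl, ht⟩)
  have h1 : ‖expConv (-(x : ℂ)) φ t‖ ≤ M / x := by
    simpa using norm_expConv_le_div (z := -(x : ℂ)) (by simpa) ht hM
  have h2 : ‖expConv (-(x : ℂ)) φ t‖ ≤ M * t := by
    refine (norm_expConv_le ht hM).trans ?_
    have := intervalIntegral.integral_mono_on (μ := volume) (g := fun _ => M)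
      (f := fun s => M * Real.exp ((-(x : ℂ)).re * (t - s))) ht
      (Continuous.intervalIntegrable (by fun_prop) _ _)
      (Continuous.intervalIntegrable (by fun_prop) _ _) (fun s hs => by
        refine mul_le_of_le_one_right hM0 (Real.exp_le_one_iff.2 ?_)
        simp only [neg_re, ofReal_re]
        nlinarith [hs.2])
    refine this.trans ?_
    simp [mul_comm]
  rw [le_div_iff₀ hx] at h1
  rw [le_div_iff₀ (by positivity)]
  linarith

theorem eq_exp_smul_of_hasDerivWithinAt {z : ℂ} {w : ℝ → X}
    (h : ∀ t, 0 ≤ t → HasDerivWithinAt w (z • w t) (Ici 0) t) {t : ℝ} (ht : 0 ≤ t) :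
    w t = cexp (z * t) • w 0 := by
  have hd : ∀ s, 0 ≤ s → HasDerivWithinAt (fun s : ℝ => cexp (-(z * s)) • w s) 0 (Ici 0) s := by
    intro s hs
    have h1 : HasDerivAt (fun s : ℝ => cexp (-(z * s))) (cexp (-(z * s)) * (-(z * 1))) s :=
      (((hasDerivAt_id s).ofReal_comp.const_mul z).neg).cexp
    have h2 := h1.hasDerivWithinAt.smul (h s hs)
    refine h2.congr_deriv ?_
    rw [smul_smul, ← add_smul]
    ring_nf
    simp
  have := constant_of_has_deriv_right_zero (a := 0) (b := t)
    (fun s hs => ((hd s hs.1).continuousWithinAt).mono Icc_subset_Ici_self)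
    (fun s hs => (hd s hs.1).mono (Ici_subset_Ici.2 hs.1)) t ⟨ht, le_rfl⟩
  simp only [ofReal_zero, mul_zero, neg_zero, Complex.exp_zero, one_smul] at this
  rw [← this, smul_smul, ← Complex.exp_add]
  simp

variable [CompleteSpace X]

theorem hasDerivAt_expConv (z : ℂ) {φ : ℝ → X} (hφ : Continuous φ) (t : ℝ) :
    HasDerivAt (expConv z φ) (z • expConv z φ t + φ t) t := by
  have h1 : HasDerivAt (fun t : ℝ => cexp (z * t)) (cexp (z * t) * (z * 1)) t :=
    ((hasDerivAt_id t).ofReal_comp.const_mul z).cexp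
  have hc : Continuous fun s : ℝ => cexp (-(z * s)) • φ s := by fun_prop
  have h2 := hc.integral_hasStrictDerivAt 0 t
  have h3 := h1.smul h2.hasDerivAt
  have he : expConv z φ = fun t : ℝ => cexp (z * t) • ∫ s in (0 : ℝ)..t, cexp (-(z * s)) • φ s :=
    funext (expConv_eq_smul z φ)
  rw [he]
  refine h3.congr_deriv ?_
  rw [smul_smul, smul_smul, ← Complex.exp_add, add_neg_cancel, Complex.exp_zero, one_smul, add_comm, mul_one,
    mul_comm (cexp (z * t)) z]

theorem continuous_expConv (z : ℂ) {φ : ℝ → X} (hφ : Continuous φ) : Continuous (expConv z φ) :=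
  continuous_iff_continuousAt.2 fun t => (hasDerivAt_expConv z hφ t).continuousAt

/-- The partial fraction identity for `1 / ((s - z) (s - w))`. The difference of the two sides
solves `v' = z v`, `v(0) = 0`. -/
theorem expConv_expConv {z w : ℂ} (hzw : z ≠ w) {φ : ℝ → X} (hφ : Continuous φ) {t : ℝ}
    (ht : 0 ≤ t) :
    expConv z (expConv w φ) t = (z - w)⁻¹ • (expConv z φ t - expConv w φ t) := by
  have h := eq_exp_smul_of_hasDerivWithinAt (z := z)
    (w := fun t => expConv z (expConv w φ) t - (z - w)⁻¹ • (expConv z φ t - expConv w φ t))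
    (fun t _ => by
      have h1 := (hasDerivAt_expConv z (continuous_expConv w hφ) t).sub
        (((hasDerivAt_expConv z hφ t).sub (hasDerivAt_expConv w hφ t)).const_smul (z - w)⁻¹)
      refine HasDerivAt.hasDerivWithinAt ?_
      refine h1.congr_deriv ?_
      have hne : z - w ≠ 0 := sub_ne_zero.2 hzw
      have e : expConv w φ t = (z - w)⁻¹ • (z - w) • expConv w φ t := by
        rw [smul_smul, inv_mul_cancel₀ hne, one_smul]
      linear_combination (norm := module) (1 : ℂ) • e) ht
  simpa [sub_eq_zero] using h

theorem expConv_expConv_zero (z : ℂ) {φ : ℝ → X} (hφ : Continuous φ) {t : ℝ} (ht : 0 ≤ t) :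
    expConv 0 φ t + z • expConv z (expConv 0 φ) t = expConv z φ t := by
  rcases eq_or_ne z 0 with rfl | hz
  · simp
  · rw [expConv_expConv hz hφ ht, sub_zero, smul_smul, mul_inv_cancel₀ hz, one_smul]
    abel

end

section

variable {X : Type*} [NormedAddCommGroup X] [NormedSpace ℂ X]

/-! ### Riemann–Liouville integrals -/

/-- The Riemann–Liouville integral of order `β`, written as an integral over `[0, 1]` so that it is
continuous on the whole line. -/
noncomputable def rlInt (β : ℝ) (φ : ℝ → X) (t : ℝ) : X :=
  (t ^ β / Real.Gamma β) • ∫ θ in (0 : ℝ)..1, (1 - θ) ^ (β - 1) • φ (t * θ)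

theorem intervalIntegrable_sub_rpow {β : ℝ} (hβ : 0 < β) (t : ℝ) :
    IntervalIntegrable (fun s : ℝ => (t - s) ^ (β - 1)) volume 0 t := by
  have h := (intervalIntegral.intervalIntegrable_rpow' (a := 0) (b := t)
    (by linarith : -1 < β - 1)).comp_sub_left t
  simpa using h.symm

theorem exists_norm_le_of_continuous {X : Type*} [NormedAddCommGroup X] {φ : ℝ → X} (hφ : Continuous φ) (a b : ℝ) :
    ∃ M, 0 ≤ M ∧ ∀ s ∈ Icc a b, ‖φ s‖ ≤ M := by
  obtain ⟨M, hM⟩ := isCompact_Icc.exists_bound_of_continuousOn (s := Icc a b) hφ.continuousOn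
  exact ⟨max M 0, le_max_right _ _, fun s hs => (hM s hs).trans (le_max_left _ _)⟩

theorem continuous_rlInt {β : ℝ} (hβ : 0 < β) {φ : ℝ → X} (hφ : Continuous φ) :
    Continuous (rlInt β φ) := by
  have h1 : Continuous fun t : ℝ => t ^ β / Real.Gamma β :=
    (Real.continuous_rpow_const hβ.le).div_const _
  refine h1.smul (continuous_iff_continuousAt.2 fun t₀ => ?_)
  obtain ⟨M, hM0, hM⟩ := exists_norm_le_of_continuous hφ (-(|t₀| + 1)) (|t₀| + 1)
  have hm : Measurable fun θ : ℝ => (1 - θ) ^ (β - 1) := by fun_prop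
  refine intervalIntegral.continuousAt_of_dominated_interval
    (bound := fun θ => (1 - θ) ^ (β - 1) * M) ?_ ?_
    ((intervalIntegrable_sub_rpow hβ 1).mul_const M) ?_
  · exact Eventually.of_forall fun t => hm.aestronglyMeasurable.smul
      (Continuous.aestronglyMeasurable (by fun_prop))
  · filter_upwards [Metric.ball_mem_nhds t₀ one_pos] with t ht
    refine Eventually.of_forall fun θ hθ => ?_
    rw [uIoc_of_le zero_le_one] at hθ
    have h0 : 0 ≤ 1 - θ := by linarith [hθ.2]
    rw [norm_smul, Real.norm_of_nonneg (by positivity)]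
    gcongr
    refine hM _ (abs_le.1 ?_)
    rw [Metric.mem_ball, Real.dist_eq] at ht
    have h3 : |t| ≤ |t₀| + 1 := by
      have := abs_sub_abs_le_abs_sub t t₀
      linarith
    rw [abs_mul, abs_of_pos hθ.1]
    calc |t| * θ ≤ |t| * 1 := by gcongr; exact hθ.2
      _ ≤ _ := by linarith
  · exact Eventually.of_forall fun θ _ => by fun_prop

theorem rlInt_eq_integral {β : ℝ} (hβ : 0 < β) (φ : ℝ → X) {t : ℝ} (ht : 0 ≤ t) :
    rlInt β φ t = ∫ τ in (0 : ℝ)..t, gker β (t - τ) • φ τ := by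
  rcases ht.eq_or_lt with rfl | ht
  · simp [rlInt, Real.zero_rpow hβ.ne']
  · have h := intervalIntegral.smul_integral_comp_mul_left (a := 0) (b := 1)
      (fun τ => gker β (t - τ) • φ τ) t
    rw [mul_zero, mul_one] at h
    rw [← h, rlInt, ← intervalIntegral.integral_smul, ← intervalIntegral.integral_smul]
    refine intervalIntegral.integral_congr fun θ hθ => ?_
    rw [uIcc_of_le zero_le_one] at hθ
    simp only [smul_smul, gker]
    congr 1
    rw [show t - t * θ = t * (1 - θ) by ring, Real.mul_rpow ht.le (by linarith [hθ.2]),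
      Real.rpow_sub_one ht.ne']
    field_simp

theorem aestronglyMeasurable_smul_of_continuous {β : Type*} [TopologicalSpace β]
    [MeasurableSpace β] [OpensMeasurableSpace β] [SecondCountableTopology β] {f : β → ℝ}
    (hf : Measurable f) {g : β → X} (hg : Continuous g) (μ : Measure β) :
    AEStronglyMeasurable (fun x => f x • g x) μ :=
  hf.aestronglyMeasurable.smul hg.aestronglyMeasurable

theorem rlInt_one (φ : ℝ → X) {t : ℝ} (ht : 0 ≤ t) : rlInt 1 φ t = expConv 0 φ t := by
  rw [rlInt_eq_integral one_pos φ ht]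
  simp [gker, expConv]

theorem continuous_expConv_neg_left {φ : ℝ → X} (hφ : Continuous φ) (t : ℝ) :
    Continuous fun x : ℝ => expConv (-(x : ℂ)) φ t :=
  (continuous_uncurry_expConv_neg hφ).comp (by fun_prop : Continuous fun x : ℝ => (x, t))

theorem integrableOn_rpow_smul_expConv {α : ℝ} (h0 : 0 < α) (h1 : α < 1) {φ : ℝ → X}
    (hφ : Continuous φ) {t : ℝ} (ht : 0 ≤ t) :
    IntegrableOn (fun x : ℝ => x ^ (α - 1) • expConv (-(x : ℂ)) φ t) (Ioi 0) := by
  obtain ⟨M, hM0, hM⟩ := exists_norm_le_of_continuous hφ 0 t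
  refine ((integrableOn_rpow_div_one_add h0 h1).const_mul (M * (1 + t))).mono'
    (aestronglyMeasurable_smul_of_continuous (by fun_prop)
      (continuous_expConv_neg_left hφ t) _) ?_
  refine (ae_restrict_mem measurableSet_Ioi).mono fun x hx => ?_
  have hx : 0 < x := hx
  rw [norm_smul, Real.norm_of_nonneg (by positivity)]
  calc _ ≤ x ^ (α - 1) * (M * (1 + t) / (1 + x)) := by
        gcongr
        exact norm_expConv_neg_le ht hx hM
    _ = _ := by ring

variable [CompleteSpace X]

/-- The semigroup law `J^(1-α) J^α = J^1`: after Fubini the inner integral is the beta integral,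
which is constant in `r`. -/
theorem rlInt_rlInt {α : ℝ} (h0 : 0 < α) (h1 : α < 1) {φ : ℝ → X} (hφ : Continuous φ) {t : ℝ}
    (ht : 0 ≤ t) : rlInt (1 - α) (rlInt α φ) t = expConv 0 φ t := by
  have h1' : 0 < 1 - α := by linarith
  -- Cutting the kernel off outside the triangle `r < s` lets Fubini run on a square.
  set k : ℝ → ℝ → ℝ := fun s r => if r < s then (t - s) ^ (-α) * (s - r) ^ (α - 1) else 0 with hk
  set B : ℝ := (balakrishnanConst α)⁻¹ with hB
  have hBpos : 0 < B := inv_pos.2 (balakrishnanConst_pos h0 h1)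
  have hk0 : ∀ r, ∀ s ∈ Ioc 0 t, 0 ≤ k s r := by
    intro r s hs
    simp only [hk]
    split_ifs with h
    · have h2 : 0 ≤ t - s := by linarith [hs.2]
      have h3 : 0 ≤ s - r := by linarith
      positivity
    · exact le_rfl
  have hkB : ∀ r ∈ Ioo 0 t, ∫ s in Ioc 0 t, k s r = B := by
    intro r hr
    rw [hB, ← integral_sub_rpow_mul_sub_rpow h0 h1 hr.2, intervalIntegral.integral_of_le hr.2.le]
    have : ∀ s, k s r = (Ioi r).indicator (fun s => (t - s) ^ (-α) * (s - r) ^ (α - 1)) s := by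
      intro s
      simp only [hk, indicator, mem_Ioi]
    simp_rw [this]
    rw [setIntegral_indicator measurableSet_Ioi]
    congr 2
    ext s
    simp only [mem_inter_iff, mem_Ioc, mem_Ioi]
    constructor
    · rintro ⟨⟨_, h⟩, h'⟩; exact ⟨h', h⟩
    · rintro ⟨h', h⟩; exact ⟨⟨hr.1.trans h', h⟩, h'⟩
  have hae : ∀ᵐ r ∂(volume.restrict (Ioc 0 t)), r ∈ Ioo 0 t := by
    rw [← restrict_Ioo_eq_restrict_Ioc]
    exact ae_restrict_mem measurableSet_Ioo
  have hkm : Measurable fun p : ℝ × ℝ => k p.1 p.2 := by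
    simp only [hk]
    exact Measurable.ite (measurableSet_lt measurable_snd measurable_fst) (by fun_prop)
      measurable_const
  have hint : Integrable (fun p : ℝ × ℝ => k p.1 p.2 • φ p.2)
      ((volume.restrict (Ioc 0 t)).prod (volume.restrict (Ioc 0 t))) := by
    rw [integrable_prod_iff' (aestronglyMeasurable_smul_of_continuous hkm
      (g := fun p => φ p.2) (by fun_prop) _)]
    constructor
    · refine hae.mono fun r hr => ?_
      refine Integrable.smul_const ?_ (φ r)
      exact Integrable.of_integral_ne_zero (by rw [hkB r hr]; exact hBpos.ne')
    · have : Integrable (fun r => B * ‖φ r‖) (volume.restrict (Ioc 0 t)) :=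
        (Continuous.integrableOn_Ioc (by fun_prop))
      refine this.congr (hae.mono fun r hr => ?_)
      simp only [norm_smul]
      rw [integral_mul_const, ← hkB r hr]
      congr 1
      exact setIntegral_congr_fun measurableSet_Ioc fun s hs =>
        (Real.norm_of_nonneg (hk0 r s hs)).symm
  have e1 : ∀ s ∈ Ioc 0 t, ∫ r in Ioc 0 t, k s r • φ r
      = (Real.Gamma α * (t - s) ^ (-α)) • rlInt α φ s := by
    intro s hs
    rw [rlInt_eq_integral h0 φ hs.1.le, intervalIntegral.integral_of_le hs.1.le, ← integral_smul,
      ← restrict_Ioo_eq_restrict_Ioc (b := s)]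
    have : ∀ r, k s r • φ r
        = (Iio s).indicator (fun r => ((t - s) ^ (-α) * (s - r) ^ (α - 1)) • φ r) r := by
      intro r
      simp only [hk, indicator, mem_Iio]
      split_ifs <;> simp
    simp_rw [this]
    rw [setIntegral_indicator measurableSet_Iio]
    have hset : Ioc 0 t ∩ Iio s = Ioo 0 s := by
      ext r
      simp only [mem_inter_iff, mem_Ioc, mem_Iio, mem_Ioo]
      exact ⟨fun h => ⟨h.1.1, h.2⟩, fun h => ⟨⟨h.1, h.2.le.trans hs.2⟩, h.2⟩⟩
    rw [hset]
    congr 1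
    ext r
    rw [smul_smul, gker]
    congr 1
    have := (Real.Gamma_pos_of_pos h0).ne'
    field_simp
  have e2 : rlInt (1 - α) (rlInt α φ) t
      = balakrishnanConst α • ∫ s in Ioc 0 t, ∫ r in Ioc 0 t, k s r • φ r := by
    rw [rlInt_eq_integral h1' _ ht, intervalIntegral.integral_of_le ht, ← integral_smul]
    refine setIntegral_congr_fun measurableSet_Ioc fun s hs => ?_
    rw [e1 s hs, smul_smul, gker, balakrishnanConst]
    congr 1
    have := (Real.Gamma_pos_of_pos h0).ne'
    have := (Real.Gamma_pos_of_pos h1').ne'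
    rw [show 1 - α - 1 = -α by ring]
    field_simp
  rw [e2, integral_integral_swap hint]
  have e3 : ∫ r in Ioc 0 t, ∫ s in Ioc 0 t, k s r • φ r = ∫ r in Ioc 0 t, B • φ r := by
    refine integral_congr_ae (hae.mono fun r hr => ?_)
    simp only
    rw [integral_smul_const, hkB r hr]
  rw [e3, integral_smul, smul_smul, hB, mul_inv_cancel₀ (balakrishnanConst_pos h0 h1).ne',
    one_smul, expConv, intervalIntegral.integral_of_le ht]
  simp

/-- The kernel of `J^(1-α)` is a superposition of decaying exponentials: `(t - s) ^ (-α)` is, up to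
`Γ(α)`, the Laplace transform of `x ^ (α - 1)` at `t - s`. -/
theorem rlInt_one_sub_eq {α : ℝ} (h0 : 0 < α) (h1 : α < 1) {φ : ℝ → X}
    (hφ : Continuous φ) {t : ℝ} (ht : 0 ≤ t) :
    rlInt (1 - α) φ t = balakrishnanConst α •
      ∫ x in Ioi (0 : ℝ), x ^ (α - 1) • expConv (-(x : ℂ)) φ t := by
  have h1' : 0 < 1 - α := by linarith
  have hae : ∀ᵐ s ∂(volume.restrict (Ioc 0 t)), s ∈ Ioo 0 t := by
    rw [← restrict_Ioo_eq_restrict_Ioc]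
    exact ae_restrict_mem measurableSet_Ioo
  have hG : ∀ s ∈ Ioo 0 t, ∫ x in Ioi (0 : ℝ), x ^ (α - 1) * Real.exp (-((t - s) * x))
      = Real.Gamma α * (t - s) ^ (-α) := by
    intro s hs
    have h2 : 0 < t - s := by linarith [hs.2]
    rw [Real.integral_rpow_mul_exp_neg_mul_Ioi h0 h2, one_div, Real.inv_rpow h2.le,
      ← Real.rpow_neg h2.le, mul_comm]
  have hint : Integrable (fun p : ℝ × ℝ =>
      (p.1 ^ (α - 1) * Real.exp (-((t - p.2) * p.1))) • φ p.2)
      ((volume.restrict (Ioi 0)).prod (volume.restrict (Ioc 0 t))) := by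
    rw [integrable_prod_iff' (aestronglyMeasurable_smul_of_continuous
      (f := fun p => p.1 ^ (α - 1) * Real.exp (-((t - p.2) * p.1))) (by fun_prop)
      (g := fun p => φ p.2) (by fun_prop) _)]
    constructor
    · refine hae.mono fun s hs => ?_
      refine Integrable.smul_const ?_ (φ s)
      refine Integrable.of_integral_ne_zero ?_
      simp only
      rw [hG s hs]
      have h2 : 0 < t - s := by linarith [hs.2]
      positivity
    · have h3 := ((intervalIntegrable_iff_integrableOn_Ioc_of_le ht).1
        (((intervalIntegrable_sub_rpow h1' t).const_mul (Real.Gamma α)).mul_continuousOn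
          (hφ.norm.continuousOn)))
      refine Integrable.congr h3 (hae.mono fun s hs => ?_)
      simp only [norm_smul]
      rw [integral_mul_const, show 1 - α - 1 = -α by ring, ← hG s hs]
      congr 1
      refine setIntegral_congr_fun measurableSet_Ioi fun x hx => ?_
      have hx : 0 < x := hx
      exact (Real.norm_of_nonneg (by positivity)).symm
  have e1 : ∀ x : ℝ, x ^ (α - 1) • expConv (-(x : ℂ)) φ t
      = ∫ s in Ioc 0 t, (x ^ (α - 1) * Real.exp (-((t - s) * x))) • φ s := by
    intro x
    rw [expConv, intervalIntegral.integral_of_le ht, ← integral_smul]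
    congr 1
    ext s
    rw [mul_smul, ← Complex.coe_smul (Real.exp _)]
    congr 2
    push_cast
    ring_nf
  simp_rw [e1]
  rw [integral_integral_swap hint, rlInt_eq_integral h1' _ ht,
    intervalIntegral.integral_of_le ht, ← integral_smul]
  refine integral_congr_ae (hae.mono fun s hs => ?_)
  simp only
  rw [integral_smul_const, hG s hs, smul_smul, gker, balakrishnanConst]
  congr 1
  have := (Real.Gamma_pos_of_pos h0).ne'
  have := (Real.Gamma_pos_of_pos h1').ne'
  rw [show 1 - α - 1 = -α by ring]
  field_simp

end

section

variable {X : Type*} [NormedAddCommGroup X] [NormedSpace ℂ X]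

/-! ### The regular part of the fractional derivative of an exponential convolution -/

/-- For `0 < α < 1` this is convolution with the integrable kernel whose Laplace transform is
`(s ^ α - z ^ α) / (s - z)`; for `α = 1` it is the identity. -/
noncomputable def fracKer (α : ℝ) (z : ℂ) (φ : ℝ → X) (t : ℝ) : X :=
  -- The integrand has symbol `x ^ α / ((x + z) (x + s))`. Since `x / ((x + z) (x + s))` equals `(s
  -- / (x + s) - z / (x + z)) / (s - z)`, Balakrishnan's formula at `s` and at `z` gives the stated
  -- symbol.
  if α < 1 then balakrishnanConst α •
    ∫ x in Ioi (0 : ℝ), ((x : ℂ) + z)⁻¹ • (x ^ α • expConv (-(x : ℂ)) φ t)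
  else φ t

theorem norm_rpow_smul_expConv_le {α : ℝ} {φ : ℝ → X} {M t x : ℝ} (ht : 0 ≤ t) (hx : 0 < x)
    (hM : ∀ s ∈ Icc 0 t, ‖φ s‖ ≤ M) :
    ‖x ^ α • expConv (-(x : ℂ)) φ t‖ ≤ M * x ^ (α - 1) := by
  have h1 : ‖expConv (-(x : ℂ)) φ t‖ ≤ M / x := by
    simpa using norm_expConv_le_div (z := -(x : ℂ)) (by simpa) ht hM
  rw [norm_smul, Real.norm_of_nonneg (by positivity), Real.rpow_sub_one hx.ne']
  calc _ ≤ x ^ α * (M / x) := by gcongr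
    _ = _ := by ring

theorem integrableOn_fracKer {α : ℝ} (h0 : 0 < α) (h1 : α < 1) {z : ℂ} (hz : z ∈ slitPlane)
    {φ : ℝ → X} (hφ : Continuous φ) {t : ℝ} (ht : 0 ≤ t) :
    IntegrableOn (fun x : ℝ => ((x : ℂ) + z)⁻¹ • (x ^ α • expConv (-(x : ℂ)) φ t)) (Ioi 0) := by
  obtain ⟨M, hM0, hM⟩ := exists_norm_le_of_continuous hφ 0 t
  exact integrableOn_stieltjes (C := M) h0 h1
    (aestronglyMeasurable_smul_of_continuous (by fun_prop) (continuous_expConv_neg_left hφ t) _)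
    (fun x hx => norm_rpow_smul_expConv_le ht hx hM) hz

theorem fracKer_congr {α : ℝ} {z : ℂ} {φ ψ : ℝ → X} {t : ℝ} (ht : 0 ≤ t)
    (h : ∀ s ∈ Icc 0 t, φ s = ψ s) : fracKer α z φ t = fracKer α z ψ t := by
  unfold fracKer
  simp_rw [fun x : ℝ => expConv_congr (z := -(x : ℂ)) ht h, h t ⟨ht, le_rfl⟩]

theorem fracKer_add {α : ℝ} (h0 : 0 < α) {z : ℂ} (hz : z ∈ slitPlane) {φ ψ : ℝ → X}
    (hφ : Continuous φ) (hψ : Continuous ψ) {t : ℝ} (ht : 0 ≤ t) :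
    fracKer α z (fun s => φ s + ψ s) t = fracKer α z φ t + fracKer α z ψ t := by
  unfold fracKer
  split_ifs with h1
  · rw [← smul_add, ← integral_add (integrableOn_fracKer h0 h1 hz hφ ht)
      (integrableOn_fracKer h0 h1 hz hψ ht)]
    simp_rw [fun x : ℝ => expConv_add (-(x : ℂ)) hφ hψ t, smul_add]
  · rfl

variable [CompleteSpace X]

theorem fracKer_clm {α : ℝ} (h0 : 0 < α) {z : ℂ} (hz : z ∈ slitPlane) (T : X →L[ℂ] X)
    {φ : ℝ → X} (hφ : Continuous φ) {t : ℝ} (ht : 0 ≤ t) :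
    fracKer α z (fun s => T (φ s)) t = T (fracKer α z φ t) := by
  unfold fracKer
  split_ifs with h1
  · have h := T.integral_comp_comm (integrableOn_fracKer h0 h1 hz hφ ht)
    rw [← Complex.coe_smul, ← Complex.coe_smul, map_smul, ← h]
    simp_rw [fun x : ℝ => expConv_clm T (-(x : ℂ)) hφ t, ← Complex.coe_smul, map_smul]
  · rfl

/-- Insert the exponential superposition for `J^(1-α)`, swap the integrals, and split each product
of exponentials with `expConv_expConv`. -/
theorem expConv_rlInt_one_sub {α : ℝ} (h0 : 0 < α) (h1 : α < 1) {z : ℂ} (hz : z ∈ slitPlane)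
    {φ : ℝ → X} (hφ : Continuous φ) {t : ℝ} (ht : 0 ≤ t) :
    expConv z (rlInt (1 - α) φ) t = balakrishnanConst α • ∫ x in Ioi (0 : ℝ),
      x ^ (α - 1) • (((x : ℂ) + z)⁻¹ • (expConv z φ t - expConv (-(x : ℂ)) φ t)) := by
  obtain ⟨M, hM0, hM⟩ := exists_norm_le_of_continuous hφ 0 t
  obtain ⟨K, hK⟩ : ∃ K, ∀ s ∈ Icc 0 t, ‖cexp (z * (t - s))‖ ≤ K :=
    isCompact_Icc.exists_bound_of_continuousOn (Continuous.continuousOn (by fun_prop))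
  have hK0 : 0 ≤ K := (norm_nonneg _).trans (hK 0 ⟨le_rfl, ht⟩)
  have hcont : Continuous fun p : ℝ × ℝ =>
      cexp (z * (t - p.2)) • expConv (-(p.1 : ℂ)) φ p.2 :=
    Continuous.smul (by fun_prop) (continuous_uncurry_expConv_neg hφ)
  have hint : Integrable (fun p : ℝ × ℝ =>
      p.1 ^ (α - 1) • (cexp (z * (t - p.2)) • expConv (-(p.1 : ℂ)) φ p.2))
      ((volume.restrict (Ioi 0)).prod (volume.restrict (Ioc 0 t))) := by
    have hD : Integrable (fun p : ℝ × ℝ => p.1 ^ (α - 1) / (1 + p.1) * (K * (M * (1 + t))))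
        ((volume.restrict (Ioi 0)).prod (volume.restrict (Ioc 0 t))) :=
      (integrableOn_rpow_div_one_add h0 h1).mul_prod (integrable_const (K * (M * (1 + t))))
    refine hD.mono' (aestronglyMeasurable_smul_of_continuous (f := fun p : ℝ × ℝ => p.1 ^ (α - 1))
      (by fun_prop) hcont _) ?_
    rw [Measure.prod_restrict]
    refine (ae_restrict_mem (measurableSet_Ioi.prod measurableSet_Ioc)).mono fun p hp => ?_
    have hx : 0 < p.1 := hp.1
    have hs : p.2 ∈ Ioc 0 t := hp.2
    rw [norm_smul, norm_smul, Real.norm_of_nonneg (by positivity)]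
    have h3 := norm_expConv_neg_le hs.1.le hx (fun s' hs' => hM s' ⟨hs'.1, hs'.2.trans hs.2⟩)
    have h4 : M * (1 + p.2) / (1 + p.1) ≤ M * (1 + t) / (1 + p.1) := by
      gcongr
      exact hs.2
    calc _ ≤ p.1 ^ (α - 1) * (K * (M * (1 + t) / (1 + p.1))) := by
          gcongr
          · exact hK _ ⟨hs.1.le, hs.2⟩
          · exact h3.trans h4
      _ = _ := by ring
  have e1 : expConv z (rlInt (1 - α) φ) t = balakrishnanConst α • ∫ s in Ioc 0 t,
      ∫ x in Ioi (0 : ℝ), x ^ (α - 1) • (cexp (z * (t - s)) • expConv (-(x : ℂ)) φ s) := by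
    rw [expConv, intervalIntegral.integral_of_le ht, ← integral_smul]
    refine setIntegral_congr_fun measurableSet_Ioc fun s hs => ?_
    rw [rlInt_one_sub_eq h0 h1 hφ hs.1.le, smul_comm, ← integral_smul]
    simp_rw [smul_comm (cexp (z * (t - s)))]
  rw [e1, ← integral_integral_swap hint]
  congr 1
  refine setIntegral_congr_fun measurableSet_Ioi fun x hx => ?_
  have hne : z ≠ -(x : ℂ) := by
    rintro rfl
    have hx : 0 < x := hx
    rcases hz with h | h
    · simp at h; linarith
    · simp at h
  rw [integral_smul, ← intervalIntegral.integral_of_le ht]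
  congr 1
  have h5 := expConv_expConv hne hφ ht
  rw [sub_neg_eq_add, add_comm z] at h5
  exact h5

/-- In symbols, `s ^ (α - 1) (1 + z / (s - z)) = s ^ α / (s - z)`. The `z ^ α` term arises from
`integral_rpow_mul_inv_add`; the rest is an identity of integrands. -/
theorem rlInt_add_expConv_rlInt {α : ℝ} (h0 : 0 < α) (h1 : α < 1) {z : ℂ} (hz : z ∈ slitPlane)
    {φ : ℝ → X} (hφ : Continuous φ) {t : ℝ} (ht : 0 ≤ t) :
    rlInt (1 - α) φ t + z • expConv z (rlInt (1 - α) φ) t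
      = fracKer α z φ t + z ^ (α : ℂ) • expConv z φ t := by
  have hz0 : z ≠ 0 := slitPlane_ne_zero hz
  have hne : ∀ x ∈ Ioi (0 : ℝ), (x : ℂ) + z ≠ 0 := by
    intro x hx h
    have hx : 0 < x := hx
    rcases hz with hz | hz
    · have : z = -(x : ℂ) := by linear_combination h
      rw [this] at hz; simp at hz; linarith
    · have : z = -(x : ℂ) := by linear_combination h
      rw [this] at hz; simp at hz
  have i1 := integrableOn_fracKer h0 h1 hz hφ ht
  have i2 := integrableOn_rpow_smul_expConv h0 h1 hφ ht
  have i3 : IntegrableOn (fun x : ℝ => ((x : ℂ) + z)⁻¹ • ((x ^ (α - 1) : ℝ) : ℂ)) (Ioi 0) := by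
    refine integrableOn_stieltjes (C := 1) h0 h1
      (Measurable.aestronglyMeasurable (by fun_prop)) (fun x hx => ?_) hz
    rw [norm_real, Real.norm_of_nonneg (by positivity), one_mul]
  have i4 := (i3.smul_const (z • expConv z φ t))
  have e : ∀ x ∈ Ioi (0 : ℝ),
      z • (x ^ (α - 1) • (((x : ℂ) + z)⁻¹ • (expConv z φ t - expConv (-(x : ℂ)) φ t)))
      = (((x : ℂ) + z)⁻¹ • (x ^ α • expConv (-(x : ℂ)) φ t)
        + (((x : ℂ) + z)⁻¹ • ((x ^ (α - 1) : ℝ) : ℂ)) • (z • expConv z φ t))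
        - x ^ (α - 1) • expConv (-(x : ℂ)) φ t := by
    intro x hx
    have h2 := hne x hx
    have hx : 0 < x := hx
    have h3 : x ^ α = x * x ^ (α - 1) := by
      rw [Real.rpow_sub_one hx.ne']; field_simp
    have h4 : x ^ (α - 1) • expConv (-(x : ℂ)) φ t = (((x : ℂ) + z)⁻¹ * ((x : ℂ) + z)) •
        (x ^ (α - 1) • expConv (-(x : ℂ)) φ t) := by rw [inv_mul_cancel₀ h2, one_smul]
    rw [h4, h3]
    simp only [← Complex.coe_smul]
    push_cast
    module
  have i5 : IntegrableOn (fun x : ℝ => ((x : ℂ) + z)⁻¹ • (x ^ α • expConv (-(x : ℂ)) φ t)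
        + (((x : ℂ) + z)⁻¹ • ((x ^ (α - 1) : ℝ) : ℂ)) • (z • expConv z φ t)) (Ioi 0) := i1.add i4
  have hI := setIntegral_congr_fun (μ := volume) measurableSet_Ioi e
  rw [integral_smul, integral_sub i5 i2, integral_add i1 i4, integral_smul_const,
    integral_rpow_mul_inv_add h0 h1 hz] at hI
  rw [fracKer, if_pos h1, rlInt_one_sub_eq h0 h1 hφ ht, expConv_rlInt_one_sub h0 h1 hz hφ ht,
    smul_comm z, hI]
  have hc : (balakrishnanConst α : ℂ) ≠ 0 := by
    exact_mod_cast (balakrishnanConst_pos h0 h1).ne'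
  have hp : z ^ (α : ℂ) = (balakrishnanConst α : ℂ) *
      (((balakrishnanConst α)⁻¹ : ℝ) * z ^ ((α : ℂ) - 1) * z) := by
    rw [cpow_sub _ _ hz0, cpow_one]
    push_cast
    field_simp
  rw [hp]
  simp only [← Complex.coe_smul]
  module

/-- The operator `fracKer α z + z ^ α • expConv z` inverts the Riemann–Liouville integral up to
convolution with the exponential. -/
theorem fracKer_rlInt {α : ℝ} (h0 : 0 < α) (h1 : α ≤ 1) {z : ℂ} (hz : z ∈ slitPlane)
    {φ : ℝ → X} (hφ : Continuous φ) {t : ℝ} (ht : 0 ≤ t) :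
    fracKer α z (rlInt α φ) t + z ^ (α : ℂ) • expConv z (rlInt α φ) t = expConv z φ t := by
  rcases h1.lt_or_eq with h1 | rfl
  · rw [← rlInt_add_expConv_rlInt h0 h1 hz (continuous_rlInt h0 hφ) ht,
      rlInt_rlInt h0 h1 hφ ht, expConv_congr ht (fun s hs => rlInt_rlInt h0 h1 hφ hs.1),
      expConv_expConv_zero z hφ ht]
  · rw [fracKer, if_neg (lt_irrefl _), ofReal_one, cpow_one, rlInt_one φ ht,
      expConv_congr ht (fun s hs => rlInt_one φ hs.1), expConv_expConv_zero z hφ ht]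

/-- The resolvent form of the fractional equation, convolved with an exponential. -/
theorem expConv_eq_of_mild {α : ℝ} (h0 : 0 < α) (h1 : α ≤ 1) {z : ℂ} (hz : z ∈ slitPlane)
    (T : X →L[ℂ] X) {u F : ℝ → X} (hu : Continuous u) (hF : Continuous F) (x : X)
    (h : ∀ t, 0 ≤ t → rlInt α u t = T (z ^ (α : ℂ) • rlInt α u t - (u t - x) + rlInt α F t))
    {t : ℝ} (ht : 0 ≤ t) :
    expConv z u t = T (expConv z F t - fracKer α z (fun s => u s - x) t
      + z ^ (α : ℂ) • expConv z (fun _ => x) t) := by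
  set w := z ^ (α : ℂ) with hw
  have cu := continuous_rlInt h0 hu
  have cF := continuous_rlInt h0 hF
  have cux : Continuous fun s => u s - x := hu.sub continuous_const
  have c1 : Continuous fun s => w • rlInt α u s := cu.const_smul w
  have c2 : Continuous fun s => (-1 : ℂ) • (u s - x) := cux.const_smul _
  have c12 : Continuous fun s => w • rlInt α u s + (-1 : ℂ) • (u s - x) := c1.add c2
  have cg : Continuous fun s => w • rlInt α u s + (-1 : ℂ) • (u s - x) + rlInt α F s :=
    c12.add cF
  have h' : ∀ s ∈ Icc 0 t, rlInt α u s
      = T (w • rlInt α u s + (-1 : ℂ) • (u s - x) + rlInt α F s) := by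
    intro s hs
    have := h s hs.1
    rwa [sub_eq_add_neg, ← neg_one_smul ℂ (u s - x)] at this
  -- Homogeneity is the special case of a scalar operator in `fracKer_clm`.
  have hs1 : ∀ c : ℂ, ∀ {ψ : ℝ → X}, Continuous ψ →
      fracKer α z (fun s => c • ψ s) t = c • fracKer α z ψ t := fun c ψ hψ =>
    fracKer_clm h0 hz (c • ContinuousLinearMap.id ℂ X) hψ ht
  have k1 : fracKer α z (rlInt α u) t = T (w • fracKer α z (rlInt α u) t
      + (-1 : ℂ) • fracKer α z (fun s => u s - x) t + fracKer α z (rlInt α F) t) := by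
    rw [← hs1 w cu, ← hs1 (-1) cux, ← fracKer_add h0 hz c1 c2 ht,
      ← fracKer_add h0 hz c12 cF ht, ← fracKer_clm h0 hz T cg ht]
    exact fracKer_congr ht h'
  have k2 : expConv z (rlInt α u) t = T (w • expConv z (rlInt α u) t
      + (-1 : ℂ) • (expConv z u t - expConv z (fun _ => x) t) + expConv z (rlInt α F) t) := by
    rw [← expConv_sub z hu continuous_const, ← expConv_smul, ← expConv_smul,
      ← expConv_add z c1 c2, ← expConv_add z c12 cF, ← expConv_clm T z cg]
    exact expConv_congr ht h'
  have l1 := fracKer_rlInt h0 h1 hz hu ht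
  have l2 := fracKer_rlInt h0 h1 hz hF ht
  rw [← hw] at l1 l2
  -- This is `fracKer + w • expConv` applied to the equation. On the right the terms with `J^α u`
  -- recombine to `w • expConv z u`, which cancels the same term coming from `u - x`.
  have l3 : expConv z u t = T (w • fracKer α z (rlInt α u) t
      + (-1 : ℂ) • fracKer α z (fun s => u s - x) t + fracKer α z (rlInt α F) t)
      + w • T (w • expConv z (rlInt α u) t
      + (-1 : ℂ) • (expConv z u t - expConv z (fun _ => x) t) + expConv z (rlInt α F) t) := by
    rw [← k1, ← k2, l1]
  rw [l3, ← map_smul, ← map_add]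
  congr 1
  linear_combination (norm := module) w • l1 + l2

end

section

variable {X : Type*} [NormedAddCommGroup X] [NormedSpace ℂ X]

/-! ### The space `BUC` and its quotient -/

/-- The extension of a function on the half line by a constant. -/
def extend (φ : BUC X) (s : ℝ) : X := φ s.toNNReal

@[simp]
theorem extend_coe (φ : BUC X) (t : ℝ≥0) : extend φ t = φ t := by simp [extend]

theorem continuous_extend (φ : BUC X) : Continuous (extend φ) :=
  φ.1.continuous.comp continuous_real_toNNReal

theorem BUC.norm_apply_le (φ : BUC X) (t : ℝ≥0) : ‖φ t‖ ≤ ‖φ‖ :=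
  BoundedContinuousFunction.norm_coe_le_norm φ.1 t

theorem norm_extend_le (φ : BUC X) (s : ℝ) : ‖extend φ s‖ ≤ ‖φ‖ := φ.norm_apply_le _

theorem BUC.norm_le {φ : BUC X} {C : ℝ} (hC : 0 ≤ C) (h : ∀ t, ‖φ t‖ ≤ C) : ‖φ‖ ≤ C :=
  (BoundedContinuousFunction.norm_le hC).2 h

theorem BUC.ext {φ ψ : BUC X} (h : ∀ t, φ t = ψ t) : φ = ψ :=
  Subtype.ext (BoundedContinuousFunction.ext h)

@[simp]
theorem BUC.add_apply (φ ψ : BUC X) (t : ℝ≥0) : (φ + ψ) t = φ t + ψ t := rfl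

@[simp]
theorem BUC.sub_apply (φ ψ : BUC X) (t : ℝ≥0) : (φ - ψ) t = φ t - ψ t := rfl

@[simp]
theorem BUC.neg_apply (φ : BUC X) (t : ℝ≥0) : (-φ) t = -φ t := rfl

@[simp]
theorem BUC.smul_apply (c : ℂ) (φ : BUC X) (t : ℝ≥0) : (c • φ) t = c • φ t := rfl

/-- A bounded uniformly continuous function as an element of `BUC`. -/
def BUC.mk (g : ℝ≥0 → X) (hg : UniformContinuous g) (C : ℝ) (hC : ∀ t, ‖g t‖ ≤ C) : BUC X :=
  ⟨BoundedContinuousFunction.ofNormedAddCommGroup g hg.continuous C hC, hg⟩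

@[simp]
theorem BUC.mk_apply (g : ℝ≥0 → X) (hg : UniformContinuous g) (C : ℝ) (hC : ∀ t, ‖g t‖ ≤ C)
    (t : ℝ≥0) : BUC.mk g hg C hC t = g t := rfl

variable (X) in
/-- Evaluation at a point, as a continuous linear map. -/
noncomputable def BUC.eval (t : ℝ≥0) : BUC X →L[ℂ] X :=
  LinearMap.mkContinuous ⟨⟨fun φ => φ t, fun _ _ => rfl⟩, fun _ _ => rfl⟩ 1
    (fun φ => by simpa using φ.norm_apply_le t)

@[simp]
theorem BUC.eval_apply (t : ℝ≥0) (φ : BUC X) : BUC.eval X t φ = φ t := rfl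

/-- The constant functions. -/
def BUC.const (x : X) : BUC X := BUC.mk (fun _ => x) uniformContinuous_const ‖x‖ (fun _ => le_rfl)

instance [CompleteSpace X] : CompleteSpace (BUC X) := by
  have : IsClosed ((bucSubmodule X : Submodule ℂ (BoundedContinuousFunction ℝ≥0 X)) :
      Set (BoundedContinuousFunction ℝ≥0 X)) := by
    refine IsSeqClosed.isClosed fun F f hF hf => ?_
    exact (BoundedContinuousFunction.tendsto_iff_tendstoUniformly.1 hf).uniformContinuous
      (Frequently.of_forall hF)
  exact this.completeSpace_coe

instance [CompleteSpace X] : CompleteSpace (Y X) :=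
  inferInstanceAs (CompleteSpace (BUC X ⧸ C0 X))

theorem norm_cls_le (φ : BUC X) : ‖cls X φ‖ ≤ ‖φ‖ := Submodule.Quotient.norm_mk_le (C0 X) φ

theorem exists_cls_eq (y : Y X) : ∃ φ, cls X φ = y := Submodule.mkQ_surjective _ y

theorem exists_cls_eq_norm_lt (y : Y X) {ε : ℝ} (hε : 0 < ε) :
    ∃ φ, cls X φ = y ∧ ‖φ‖ < ‖y‖ + ε :=
  Submodule.Quotient.norm_mk_lt (S := C0 X) y hε

theorem cls_eq_cls_iff {φ ψ : BUC X} : cls X φ = cls X ψ ↔ φ - ψ ∈ C0 X := by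
  rw [← cls_eq_zero_iff, map_sub, sub_eq_zero]

variable (X) in
/-- The quotient map as a continuous linear map. -/
noncomputable def clsL : BUC X →L[ℂ] Y X :=
  (cls X).mkContinuous 1 (fun φ => by simpa using norm_cls_le φ)

/-- The operator induced on the quotient by a bounded operator that leaves `C0` invariant. -/
noncomputable def descend (T : BUC X →L[ℂ] BUC X) (hT : ∀ φ ∈ C0 X, T φ ∈ C0 X) : Y X →L[ℂ] Y X :=
  LinearMap.mkContinuous ((C0 X).mapQ (C0 X) T.toLinearMap hT : (BUC X ⧸ C0 X) →ₗ[ℂ] (BUC X ⧸ C0 X))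
    ‖T‖ (fun y => by
      refine le_of_forall_pos_le_add fun ε hε => ?_
      -- The added `1` covers `‖T‖ = 0` when choosing a representative with norm excess `ε / (‖T‖ +
      -- 1)`.
      have hp : 0 < ‖T‖ + 1 := by positivity
      obtain ⟨φ, rfl, hφ⟩ := exists_cls_eq_norm_lt y (div_pos hε hp)
      have h1 : ‖cls X (T φ)‖ ≤ ‖T‖ * ‖φ‖ := (norm_cls_le _).trans (T.le_opNorm φ)
      refine h1.trans ?_
      calc ‖T‖ * ‖φ‖ ≤ ‖T‖ * (‖cls X φ‖ + ε / (‖T‖ + 1)) := by gcongr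
        _ = ‖T‖ * ‖cls X φ‖ + ε * (‖T‖ / (‖T‖ + 1)) := by ring
        _ ≤ ‖T‖ * ‖cls X φ‖ + ε * 1 := by
          gcongr
          rw [div_le_one hp]
          linarith
        _ = _ := by rw [mul_one])

@[simp]
theorem descend_cls (T : BUC X →L[ℂ] BUC X) (hT : ∀ φ ∈ C0 X, T φ ∈ C0 X) (φ : BUC X) :
    descend T hT (cls X φ) = cls X (T φ) := rfl

theorem norm_descend_le (T : BUC X →L[ℂ] BUC X) (hT : ∀ φ ∈ C0 X, T φ ∈ C0 X) :
    ‖descend T hT‖ ≤ ‖T‖ :=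
  LinearMap.mkContinuous_norm_le _ (norm_nonneg T) _

/-- Composition with a bounded operator of the target space. -/
noncomputable def BUC.comp (T : X →L[ℂ] X) : BUC X →L[ℂ] BUC X :=
  LinearMap.mkContinuous
    { toFun := fun φ => BUC.mk (fun t => T (φ t)) (T.uniformContinuous.comp φ.2) (‖T‖ * ‖φ‖)
        (fun t => (T.le_opNorm _).trans (by gcongr; exact φ.norm_apply_le t))
      map_add' := fun φ ψ => BUC.ext fun t => map_add T _ _
      map_smul' := fun c φ => BUC.ext fun t => map_smul T _ _ } ‖T‖
    (fun φ => BUC.norm_le (by positivity)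
      (fun t => (T.le_opNorm _).trans (by gcongr; exact φ.norm_apply_le t)))

@[simp]
theorem BUC.comp_apply (T : X →L[ℂ] X) (φ : BUC X) (t : ℝ≥0) : BUC.comp T φ t = T (φ t) := rfl

theorem BUC.norm_comp_le (T : X →L[ℂ] X) : ‖BUC.comp T‖ ≤ ‖T‖ :=
  LinearMap.mkContinuous_norm_le _ (norm_nonneg _) _

theorem BUC.comp_mem_C0 (T : X →L[ℂ] X) : ∀ φ ∈ C0 X, BUC.comp T φ ∈ C0 X := by
  intro φ hφ
  rw [mem_C0] at hφ ⊢
  exact (T.continuous.tendsto' 0 0 (map_zero T)).comp hφ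

theorem uniformContinuous_add_one_comp (φ : BUC X) :
    UniformContinuous (fun t : ℝ≥0 => φ (t + 1)) := by
  have h : UniformContinuous (fun t => φ t) := φ.2
  refine h.comp (Metric.uniformContinuous_iff.2 fun ε hε => ⟨ε, hε, fun a b hab => ?_⟩)
  rw [NNReal.dist_eq] at hab ⊢
  push_cast
  rwa [add_sub_add_right_eq_sub]

variable (X) in
/-- The action on the quotient of the bounded operators of the target space. -/
noncomputable def compY : (X →L[ℂ] X) →L[ℂ] Y X →L[ℂ] Y X :=
  LinearMap.mkContinuous
    { toFun := fun T => descend (BUC.comp T) (BUC.comp_mem_C0 T)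
      map_add' := fun T S => by
        ext y
        obtain ⟨φ, rfl⟩ := exists_cls_eq y
        simp only [add_apply, descend_cls, ← map_add]
        congr 1
      map_smul' := fun c T => by
        ext y
        obtain ⟨φ, rfl⟩ := exists_cls_eq y
        simp only [smul_apply, descend_cls, RingHom.id_apply]
        rw [← map_smul]
        congr 1 } 1
    (fun T => by
      rw [one_mul]
      exact (norm_descend_le _ _).trans (BUC.norm_comp_le T))

@[simp]
theorem compY_cls (T : X →L[ℂ] X) (φ : BUC X) : compY X T (cls X φ) = cls X (BUC.comp T φ) := rfl

/-- Translation by `1`. -/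
noncomputable def BUC.shift : BUC X →L[ℂ] BUC X :=
  LinearMap.mkContinuous
    { toFun := fun φ => BUC.mk (fun t => φ (t + 1))
        (uniformContinuous_add_one_comp φ) ‖φ‖ (fun t => φ.norm_apply_le _)
      map_add' := fun φ ψ => BUC.ext fun t => rfl
      map_smul' := fun c φ => BUC.ext fun t => rfl } 1
    (fun φ => by
      rw [one_mul]
      exact BUC.norm_le (norm_nonneg _) (fun t => φ.norm_apply_le _))

@[simp]
theorem BUC.shift_apply (φ : BUC X) (t : ℝ≥0) : BUC.shift φ t = φ (t + 1) := rfl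

theorem BUC.shift_mem_C0 : ∀ φ ∈ C0 X, BUC.shift φ ∈ C0 X := by
  intro φ hφ
  rw [mem_C0] at hφ ⊢
  exact hφ.comp (tendsto_atTop_mono (fun t => le_self_add) tendsto_id)

/-! ### The resolvent of `d/dt` on the half line -/

/-- The Laplace transform on the right half plane, extended by `0`. -/
noncomputable def laplace (z : ℂ) (φ : ℝ → X) : X :=
  if 0 < z.re then ∫ s in Ioi (0 : ℝ), cexp (-(z * s)) • φ s else 0

/-- The bounded solution `w` of `z w - w' = φ`. -/
noncomputable def halfRes (z : ℂ) (φ : ℝ → X) (t : ℝ) : X :=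
  cexp (z * t) • laplace z φ - expConv z φ t

theorem integrableOn_exp_smul {z : ℂ} (hz : 0 < z.re) {φ : ℝ → X} (hφ : Continuous φ) {M a : ℝ}
    (hM : ∀ s, a ≤ s → ‖φ s‖ ≤ M) : IntegrableOn (fun s : ℝ => cexp (-(z * s)) • φ s) (Ioi a) := by
  refine ((exp_neg_integrableOn_Ioi a hz).mul_const M).mono'
    (Continuous.aestronglyMeasurable (by fun_prop)) ?_
  refine (ae_restrict_mem measurableSet_Ioi).mono fun s hs => ?_
  rw [norm_smul, Complex.norm_exp]
  have : (-(z * (s : ℂ))).re = -z.re * s := by simp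
  rw [this]
  gcongr
  exact hM s (le_of_lt hs)

theorem halfRes_of_re_pos {z : ℂ} (hz : 0 < z.re) {φ : ℝ → X} (hφ : Continuous φ) {M t : ℝ}
    (ht : 0 ≤ t) (hM : ∀ s, 0 ≤ s → ‖φ s‖ ≤ M) :
    halfRes z φ t = cexp (z * t) • ∫ s in Ioi t, cexp (-(z * s)) • φ s := by
  rw [halfRes, expConv_eq_smul, ← smul_sub, laplace, if_pos hz,
    intervalIntegral.integral_of_le ht, ← Ioc_union_Ioi_eq_Ioi ht,
    setIntegral_union (Ioc_disjoint_Ioi le_rfl) measurableSet_Ioi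
      (Continuous.integrableOn_Ioc (by fun_prop))
      (integrableOn_exp_smul hz hφ fun s hs => hM s (ht.trans hs))]
  congr 1
  abel

theorem norm_halfRes_le_of_re_pos {z : ℂ} (hz : 0 < z.re) {φ : ℝ → X} (hφ : Continuous φ)
    {M M' t : ℝ} (ht : 0 ≤ t) (hM : ∀ s, 0 ≤ s → ‖φ s‖ ≤ M) (hM' : ∀ s, t ≤ s → ‖φ s‖ ≤ M') :
    ‖halfRes z φ t‖ ≤ M' / z.re := by
  rw [halfRes_of_re_pos hz hφ ht hM, norm_smul, Complex.norm_exp]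
  have h1 : ‖∫ s in Ioi t, cexp (-(z * s)) • φ s‖ ≤ ∫ s in Ioi t, Real.exp (-z.re * s) * M' := by
    refine norm_integral_le_of_norm_le ((exp_neg_integrableOn_Ioi t hz).mul_const M') ?_
    refine (ae_restrict_mem measurableSet_Ioi).mono fun s hs => ?_
    rw [norm_smul, Complex.norm_exp]
    have : (-(z * (s : ℂ))).re = -z.re * s := by simp
    rw [this]
    gcongr
    exact hM' s (le_of_lt hs)
  rw [integral_mul_const, integral_exp_mul_Ioi (by linarith)] at h1
  have e : (z * (t : ℂ)).re = z.re * t := by simp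
  rw [e]
  calc _ ≤ Real.exp (z.re * t) * (-Real.exp (-z.re * t) / -z.re * M') := by gcongr
    _ = (Real.exp (z.re * t) * Real.exp (-z.re * t)) * (M' / z.re) := by
      rw [neg_div_neg_eq]; ring
    _ = _ := by
      rw [← Real.exp_add]; simp

theorem halfRes_of_re_neg {z : ℂ} (hz : z.re < 0) (φ : ℝ → X) (t : ℝ) :
    halfRes z φ t = -expConv z φ t := by
  rw [halfRes, laplace, if_neg hz.not_gt, smul_zero, zero_sub]

theorem norm_halfRes_le {z : ℂ} (hz : z.re ≠ 0) {φ : ℝ → X} (hφ : Continuous φ) {M t : ℝ}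
    (ht : 0 ≤ t) (hM : ∀ s, 0 ≤ s → ‖φ s‖ ≤ M) : ‖halfRes z φ t‖ ≤ M / |z.re| := by
  rcases hz.lt_or_gt with h | h
  · rw [halfRes_of_re_neg h, norm_neg, abs_of_neg h]
    exact norm_expConv_le_div h ht fun s hs => hM s hs.1
  · rw [abs_of_pos h]
    exact norm_halfRes_le_of_re_pos h hφ ht hM fun s hs => hM s (ht.trans hs)

theorem laplace_add {z : ℂ} {φ ψ : ℝ → X} (hφ : Continuous φ) (hψ : Continuous ψ) {M N : ℝ}
    (hM : ∀ s, 0 ≤ s → ‖φ s‖ ≤ M) (hN : ∀ s, 0 ≤ s → ‖ψ s‖ ≤ N) :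
    laplace z (fun s => φ s + ψ s) = laplace z φ + laplace z ψ := by
  unfold laplace
  split_ifs with h
  · simp only [smul_add]
    exact integral_add (integrableOn_exp_smul h hφ hM) (integrableOn_exp_smul h hψ hN)
  · simp

theorem laplace_smul (z c : ℂ) (φ : ℝ → X) :
    laplace z (fun s => c • φ s) = c • laplace z φ := by
  unfold laplace
  split_ifs with h
  · simp only [smul_comm _ c]
    exact integral_smul _ _
  · simp

theorem eventually_exp_mul_lt {a : ℝ} (ha : a < 0) (C : ℝ) {ε : ℝ} (hε : 0 < ε) :
    ∀ᶠ t : ℝ in atTop, Real.exp (a * t) * C < ε := by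
  have h1 : Tendsto (fun t : ℝ => Real.exp (a * t) * C) atTop (𝓝 (0 * C)) :=
    (Real.tendsto_exp_atBot.comp (tendsto_id.const_mul_atTop_of_neg ha)).mul_const C
  rw [zero_mul] at h1
  exact h1.eventually_lt_const hε

variable [CompleteSpace X]

theorem expConv_add_right (z : ℂ) {φ : ℝ → X} (hφ : Continuous φ) (a : ℝ) {t : ℝ} (ht : 0 ≤ t) :
    expConv z φ (t + a) = cexp (z * t) • expConv z φ a + expConv z (fun s => φ (s + a)) t := by
  have h := eq_exp_smul_of_hasDerivWithinAt (z := z)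
    (w := fun t => expConv z φ (t + a) - expConv z (fun s => φ (s + a)) t)
    (fun t _ => by
      have h1 := ((hasDerivAt_expConv z hφ (t + a)).comp_add_const t a).sub
        (hasDerivAt_expConv z (φ := fun s => φ (s + a)) (by fun_prop) t)
      refine HasDerivAt.hasDerivWithinAt (h1.congr_deriv ?_)
      module) ht
  simp only [zero_add, expConv_zero, sub_zero] at h
  rw [← h]
  abel

/-- For `re z < 0`, restart the convolution at a time `a` after which `φ` is small; the earlier
contribution decays exponentially. For `re z > 0` only the values of `φ` after `t` enter. -/
theorem tendsto_halfRes {z : ℂ} (hz : z.re ≠ 0) {φ : ℝ → X} (hφ : Continuous φ) {M : ℝ}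
    (hM : ∀ s, 0 ≤ s → ‖φ s‖ ≤ M) (h0 : Tendsto φ atTop (𝓝 0)) :
    Tendsto (halfRes z φ) atTop (𝓝 0) := by
  rw [Metric.tendsto_atTop]
  intro ε hε
  have hr : 0 < |z.re| := abs_pos.2 hz
  obtain ⟨N, hN⟩ := Metric.tendsto_atTop.1 h0 (ε / 2 * |z.re|) (by positivity)
  set a := max N 0 with ha
  have hb : ∀ s, a ≤ s → ‖φ s‖ ≤ ε / 2 * |z.re| := by
    intro s hs
    have := hN s ((le_max_left _ _).trans hs)
    rw [dist_zero_right] at this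
    exact this.le
  rcases hz.lt_or_gt with h | h
  · obtain ⟨T, hT⟩ := eventually_atTop.1
      (eventually_exp_mul_lt h ‖expConv z φ a‖ (half_pos hε))
    refine ⟨max T 0 + a, fun t ht => ?_⟩
    have h0t : 0 ≤ t - a := by linarith [le_max_right T 0]
    have h1 := expConv_add_right z hφ a h0t
    rw [sub_add_cancel] at h1
    rw [dist_zero_right, halfRes_of_re_neg h, norm_neg, h1]
    have h2 : ‖cexp (z * ((t - a : ℝ) : ℂ)) • expConv z φ a‖ < ε / 2 := by
      rw [norm_smul, Complex.norm_exp, re_mul_ofReal]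
      exact hT _ (by linarith [le_max_left T 0])
    have h3 : ‖expConv z (fun s => φ (s + a)) (t - a)‖ ≤ ε / 2 := by
      refine (norm_expConv_le_div h h0t fun s hs => hb (s + a) (by linarith [hs.1])).trans ?_
      rw [← abs_of_neg h, mul_div_cancel_right₀ _ hr.ne']
    linarith [norm_add_le (cexp (z * ((t - a : ℝ) : ℂ)) • expConv z φ a)
      (expConv z (fun s => φ (s + a)) (t - a))]
  · refine ⟨a, fun t ht => ?_⟩
    rw [dist_zero_right]
    have := norm_halfRes_le_of_re_pos h hφ ((le_max_right N 0).trans ht) hM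
      (fun s hs => hb s (le_trans ht hs))
    rw [abs_of_pos h, mul_div_cancel_right₀ _ h.ne'] at this
    linarith

theorem hasDerivAt_halfRes (z : ℂ) {φ : ℝ → X} (hφ : Continuous φ) (t : ℝ) :
    HasDerivAt (halfRes z φ) (z • halfRes z φ t - φ t) t := by
  have h1 : HasDerivAt (fun t : ℝ => cexp (z * t)) (cexp (z * t) * (z * 1)) t :=
    ((hasDerivAt_id t).ofReal_comp.const_mul z).cexp
  refine ((h1.smul_const (laplace z φ)).sub (hasDerivAt_expConv z hφ t)).congr_deriv ?_
  rw [halfRes]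
  module

end

/-! ### The resolvent of differentiation on `BUC` and on the quotient -/

section

variable {X : Type*} [NormedAddCommGroup X] [NormedSpace ℂ X]

theorem uniformContinuous_of_hasDerivAt {w w' : ℝ → X} (h : ∀ t, HasDerivAt w (w' t) t) {C : ℝ}
    (hC : ∀ t, 0 ≤ t → ‖w' t‖ ≤ C) : UniformContinuous (fun t : ℝ≥0 => w t) := by
  have hC0 : 0 ≤ C := (norm_nonneg _).trans (hC 0 le_rfl)
  have h1 : LipschitzOnWith C.toNNReal w (Ici 0) :=
    (convex_Ici 0).lipschitzOnWith_of_nnnorm_hasDerivWithin_le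
      (fun t _ => (h t).hasDerivWithinAt) (fun t ht => by
        rw [← NNReal.coe_le_coe, coe_nnnorm, Real.coe_toNNReal _ hC0]
        exact hC t ht)
  have h2 := h1.to_restrict.uniformContinuous
  exact h2

/-- Exponentials decay if `re z < 0`, and boundedness forces `x = 0` if `re z > 0`. This is why
initial values and Laplace constants leave no trace in the quotient. -/
theorem mem_C0_of_eq_exp_smul {z : ℂ} (hz : z.re ≠ 0) {b : BUC X} {x : X}
    (h : ∀ t : ℝ≥0, b t = cexp (z * (t : ℝ)) • x) : b ∈ C0 X := by
  have hn : ∀ t : ℝ≥0, ‖b t‖ = Real.exp (z.re * t) * ‖x‖ := by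
    intro t
    rw [h t, norm_smul, Complex.norm_exp, re_mul_ofReal]
  rw [mem_C0, Metric.tendsto_atTop]
  intro ε hε
  rcases hz.lt_or_gt with hz | hz
  · obtain ⟨T, hT⟩ := eventually_atTop.1 (eventually_exp_mul_lt hz ‖x‖ hε)
    refine ⟨T.toNNReal, fun t ht => ?_⟩
    rw [dist_zero_right, hn t]
    exact hT t (Real.toNNReal_le_iff_le_coe.1 ht)
  · have hx : x = 0 := by
      by_contra hx
      have hx : 0 < ‖x‖ := norm_pos_iff.2 hx
      have hlim : Tendsto (fun t : ℝ => Real.exp (z.re * t) * ‖x‖) atTop atTop :=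
        (Real.tendsto_exp_atTop.comp (tendsto_id.const_mul_atTop hz)).atTop_mul_const hx
      obtain ⟨t, ht, ht0⟩ := ((hlim.eventually_gt_atTop ‖b‖).and (eventually_ge_atTop 0)).exists
      have h3 := b.norm_apply_le t.toNNReal
      rw [hn, Real.coe_toNNReal t ht0] at h3
      exact absurd h3 (not_le.2 ht)
    refine ⟨0, fun t _ => ?_⟩
    rw [h t, hx, smul_zero, dist_self]
    exact hε

theorem mem_C0_of_isDeriv_smul {z : ℂ} (hz : z.re ≠ 0) {w : BUC X} (h : IsDeriv w (z • w)) :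
    w ∈ C0 X := by
  refine mem_C0_of_eq_exp_smul hz (x := w 0) fun t => ?_
  have h1 := eq_exp_smul_of_hasDerivWithinAt (z := z) (w := extend w) (fun s hs => by
    have := h ⟨s, hs⟩
    have e : (⟨s, hs⟩ : ℝ≥0) = s.toNNReal := (Real.toNNReal_of_nonneg hs).symm
    rw [e, BUC.smul_apply, Real.coe_toNNReal s hs] at this
    exact this) t.2
  have h2 : extend w 0 = w 0 := by simp [extend]
  rw [h2] at h1
  exact (extend_coe w t).symm.trans h1

theorem tendsto_extend {φ : BUC X} (h : φ ∈ C0 X) : Tendsto (extend φ) atTop (𝓝 0) :=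
  ((mem_C0 φ).1 h).comp Real.tendsto_toNNReal_atTop

theorem isDeriv_of_hasDerivAt {u g : BUC X} {w : ℝ → X} (hw : ∀ t : ℝ≥0, w t = u t)
    (h : ∀ t : ℝ≥0, HasDerivAt w (g t) t) : IsDeriv u g := by
  intro t
  refine (h t).hasDerivWithinAt.congr (fun s hs => ?_) ?_
  · have hs : 0 ≤ s := hs
    rw [← hw, Real.coe_toNNReal s hs]
  · rw [← hw, Real.toNNReal_coe]

theorem mem_derivTilde_graph_iff {p : Y X × Y X} :
    p ∈ (derivTilde X).graph ↔ ∃ u g : BUC X, IsDeriv u g ∧ p = (cls X u, cls X g) := by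
  rw [derivTilde_graph]
  constructor
  · rintro ⟨⟨u, g⟩, h, rfl⟩
    exact ⟨u, g, h, rfl⟩
  · rintro ⟨u, g, h, rfl⟩
    exact ⟨(u, g), h, rfl⟩

theorem IsResolvent.apply_graph {E : Type*} [NormedAddCommGroup E] [NormedSpace ℂ E]
    {T : E →ₗ.[ℂ] E} {z : ℂ} {R : E →L[ℂ] E} (h : IsResolvent T z R) {x y : E}
    (hxy : (x, y) ∈ T.graph) : R (z • x - y) = x := by
  obtain ⟨x', rfl, hy⟩ := (LinearPMap.mem_graph_iff T).1 hxy
  simp only at hy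
  rw [← hy]
  exact h.2 x'

theorem IsResolvent.of_graph {E : Type*} [NormedAddCommGroup E] [NormedSpace ℂ E]
    {T : E →ₗ.[ℂ] E} {z : ℂ} {R : E →L[ℂ] E} (h1 : ∀ x, (R x, z • R x - x) ∈ T.graph)
    (h2 : ∀ x y, (x, y) ∈ T.graph → R (z • x - y) = x) : IsResolvent T z R := by
  refine ⟨fun x => ?_, fun y => h2 y (T y) (T.mem_graph y)⟩
  have hd : R x ∈ T.domain := LinearPMap.mem_domain_of_mem_graph (h1 x)
  refine ⟨hd, ?_⟩
  rw [← (LinearPMap.image_iff hd).2 (h1 x)]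
  abel

theorem IsResolvent.mem_graph {E : Type*} [NormedAddCommGroup E] [NormedSpace ℂ E]
    {T : E →ₗ.[ℂ] E} {z : ℂ} {R : E →L[ℂ] E} (h : IsResolvent T z R) (x : E) :
    (R x, z • R x - x) ∈ T.graph := by
  obtain ⟨hd, e⟩ := h.1 x
  refine (LinearPMap.image_iff hd).1 ?_
  nth_rewrite 2 [← e]
  abel

/-- The resolvent identity. -/
theorem IsResolvent.sub_apply {E : Type*} [NormedAddCommGroup E] [NormedSpace ℂ E]
    {T : E →ₗ.[ℂ] E} {z w : ℂ} {R S : E →L[ℂ] E} (hR : IsResolvent T z R)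
    (hS : IsResolvent T w S) : R - S = (w - z) • (R ∘L S) := by
  ext x
  have h := hR.apply_graph (hS.mem_graph x)
  have e : z • S x - (w • S x - x) = x + (z - w) • S x := by module
  rw [e, map_add, map_smul] at h
  simp only [_root_.sub_apply, smul_apply, ContinuousLinearMap.comp_apply]
  linear_combination (norm := module) h

variable [CompleteSpace X]

variable (X) in
/-- The resolvent of `d/dt` in `BUC` off the imaginary axis: the exact one for `0 < z.re`, and for
`z.re < 0` a right inverse of `z - d/dt`. -/
noncomputable def resB (z : ℂ) : BUC X →L[ℂ] BUC X :=
  open Classical in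
  LinearMap.mkContinuous
    { toFun := fun φ => if hz : z.re ≠ 0 then
        BUC.mk (fun t => halfRes z (extend φ) t)
          (uniformContinuous_of_hasDerivAt (hasDerivAt_halfRes z (continuous_extend φ))
            (C := ‖z‖ * (‖φ‖ / |z.re|) + ‖φ‖) (fun t ht => (norm_sub_le _ _).trans (by
              rw [norm_smul]
              gcongr
              · exact norm_halfRes_le hz (continuous_extend φ) ht fun s _ => norm_extend_le φ s
              · exact norm_extend_le φ t)))
          (‖φ‖ / |z.re|) (fun t => norm_halfRes_le hz (continuous_extend φ) t.2
            fun s _ => norm_extend_le φ s) else 0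
      map_add' := fun φ ψ => by
        split_ifs with hz
        · refine BUC.ext fun t => ?_
          simp only [BUC.mk_apply, BUC.add_apply, halfRes]
          have e : extend (φ + ψ) = fun s => extend φ s + extend ψ s := rfl
          rw [e, laplace_add (continuous_extend φ) (continuous_extend ψ)
            (fun s _ => norm_extend_le φ s) (fun s _ => norm_extend_le ψ s),
            expConv_add z (continuous_extend φ) (continuous_extend ψ)]
          module
        · rw [add_zero]
      map_smul' := fun c φ => by
        split_ifs with hz
        · refine BUC.ext fun t => ?_
          simp only [BUC.mk_apply, RingHom.id_apply, BUC.smul_apply, halfRes]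
          have e : extend (c • φ) = fun s => c • extend φ s := rfl
          rw [e, laplace_smul, expConv_smul]
          module
        · rw [smul_zero] } |z.re|⁻¹ (fun φ => by
      simp only [LinearMap.coe_mk, AddHom.coe_mk]
      split_ifs with hz
      · refine BUC.norm_le (by positivity) fun t => ?_
        rw [← div_eq_inv_mul]
        exact norm_halfRes_le hz (continuous_extend φ) t.2 fun s _ => norm_extend_le φ s
      · rw [norm_zero]
        positivity)

theorem norm_resB_le (z : ℂ) : ‖resB X z‖ ≤ |z.re|⁻¹ :=
  LinearMap.mkContinuous_norm_le _ (by positivity) _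

theorem resB_apply {z : ℂ} (hz : z.re ≠ 0) (φ : BUC X) (t : ℝ≥0) :
    resB X z φ t = halfRes z (extend φ) t := by
  have : resB X z φ = _ := dif_pos hz
  rw [this]
  rfl

theorem isDeriv_resB {z : ℂ} (hz : z.re ≠ 0) (φ : BUC X) :
    IsDeriv (resB X z φ) (z • resB X z φ - φ) := by
  refine isDeriv_of_hasDerivAt (fun t => (resB_apply hz φ t).symm) fun t => ?_
  refine (hasDerivAt_halfRes z (continuous_extend φ) t).congr_deriv ?_
  rw [BUC.sub_apply, BUC.smul_apply, resB_apply hz, extend_coe]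

theorem resB_mem_C0 (z : ℂ) : ∀ φ ∈ C0 X, resB X z φ ∈ C0 X := by
  intro φ hφ
  by_cases hz : z.re ≠ 0
  · rw [mem_C0]
    have h := (tendsto_halfRes hz (continuous_extend φ) (fun s _ => norm_extend_le φ s)
      (tendsto_extend hφ)).comp (NNReal.tendsto_coe_atTop.2 tendsto_id)
    simp_rw [fun t => resB_apply hz φ t]
    exact h
  · have : resB X z φ = _ := dif_neg hz
    rw [this]
    exact zero_mem _

variable (X) in
/-- The resolvent of `derivTilde X` off the imaginary axis. -/
noncomputable def resY (z : ℂ) : Y X →L[ℂ] Y X := descend (resB X z) (resB_mem_C0 z)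

@[simp]
theorem resY_cls (z : ℂ) (φ : BUC X) : resY X z (cls X φ) = cls X (resB X z φ) := rfl

theorem norm_resY_le (z : ℂ) : ‖resY X z‖ ≤ |z.re|⁻¹ :=
  (norm_descend_le _ _).trans (norm_resB_le z)

/-- For `re z < 0`, `resB` fails to be a left inverse only by multiples of `e ^ (z t)`, and these
lie in `C0`. -/
theorem isResolvent_resY {z : ℂ} (hz : z.re ≠ 0) : IsResolvent (derivTilde X) z (resY X z) := by
  refine IsResolvent.of_graph (fun y => ?_) (fun x y h => ?_)
  · obtain ⟨φ, rfl⟩ := exists_cls_eq y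
    refine mem_derivTilde_graph_iff.2 ⟨_, _, isDeriv_resB hz φ, ?_⟩
    rw [map_sub, map_smul, resY_cls]
  · obtain ⟨u, g, hug, h⟩ := mem_derivTilde_graph_iff.1 h
    obtain ⟨rfl, rfl⟩ := Prod.mk.inj h
    rw [← map_smul, ← map_sub, resY_cls, cls_eq_cls_iff]
    refine mem_C0_of_isDeriv_smul hz ?_
    have h1 := (derivGraph X).sub_mem ((mem_derivGraph (_, _)).2 (isDeriv_resB hz (z • u - g)))
      ((mem_derivGraph (u, g)).2 hug)
    have e : z • resB X z (z • u - g) - (z • u - g) - g = z • (resB X z (z • u - g) - u) := by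
      module
    rw [Prod.mk_sub_mk, e] at h1
    exact h1

theorem differentiableAt_resY {z : ℂ} (hz : z.re ≠ 0) : DifferentiableAt ℂ (resY X) z := by
  have hev : ∀ᶠ w in 𝓝 z, w.re ≠ 0 := continuous_re.continuousAt.eventually_ne hz
  have hid : ∀ᶠ w in 𝓝 z, resY X w - resY X z = (z - w) • (resY X w ∘L resY X z) :=
    hev.mono fun w hw => (isResolvent_resY hw).sub_apply (isResolvent_resY hz)
  have hbd : ∀ᶠ w in 𝓝 z, ‖resY X w‖ ≤ (|z.re| / 2)⁻¹ := by
    have : ∀ᶠ w in 𝓝 z, |z.re| / 2 < |w.re| :=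
      (continuous_re.abs.continuousAt (x := z)).eventually_const_lt
        (half_lt_self (abs_pos.2 hz))
    refine this.mono fun w hw => (norm_resY_le w).trans ?_
    have := abs_pos.2 hz
    gcongr
  have hc : Tendsto (resY X) (𝓝 z) (𝓝 (resY X z)) := by
    rw [tendsto_iff_norm_sub_tendsto_zero]
    have h1 : Tendsto (fun w => ‖z - w‖ * ((|z.re| / 2)⁻¹ * ‖resY X z‖)) (𝓝 z) (𝓝 0) := by
      have : Continuous fun w => ‖z - w‖ * ((|z.re| / 2)⁻¹ * ‖resY X z‖) := by fun_prop
      exact this.tendsto' _ _ (by simp)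
    refine squeeze_zero' (Eventually.of_forall fun _ => norm_nonneg _) ?_ h1
    filter_upwards [hid, hbd] with w h2 h3
    rw [h2, norm_smul]
    gcongr
    exact (ContinuousLinearMap.opNorm_comp_le _ _).trans (by gcongr)
  refine HasDerivAt.differentiableAt (f' := -(resY X z ∘L resY X z)) ?_
  rw [hasDerivAt_iff_tendsto_slope]
  have h4 : Tendsto (fun w => -(resY X w ∘L resY X z)) (𝓝[≠] z) (𝓝 (-(resY X z ∘L resY X z))) :=
    ((((ContinuousLinearMap.compL ℂ (Y X) (Y X) (Y X)).flip (resY X z)).continuous.tendsto _).comp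
      (hc.mono_left nhdsWithin_le_nhds)).neg
  refine h4.congr' ?_
  filter_upwards [nhdsWithin_le_nhds hid, self_mem_nhdsWithin] with w h2 hw
  have hne : w - z ≠ 0 := sub_ne_zero.2 hw
  rw [slope_def_module, h2, smul_smul, ← neg_sub w z, mul_neg, inv_mul_cancel₀ hne, neg_one_smul]

end

section

variable {X : Type*} [NormedAddCommGroup X] [NormedSpace ℂ X] [CompleteSpace X]

/-! ### The fractional equation in the quotient space -/

theorem resB_resB {z w : ℂ} (hz : z.re < 0) (hw : w.re < 0) (φ : BUC X) :
    resB X z φ - resB X w φ = (w - z) • resB X z (resB X w φ) := by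
  rcases eq_or_ne z w with rfl | hne
  · simp
  · refine BUC.ext fun t => ?_
    have e : ∀ s ∈ Icc 0 (t : ℝ),
        extend (resB X w φ) s = (-1 : ℂ) • expConv w (extend φ) s := by
      intro s hs
      rw [extend, resB_apply hw.ne, halfRes_of_re_neg hw, Real.coe_toNNReal s hs.1, neg_one_smul]
    simp only [BUC.sub_apply, BUC.smul_apply, resB_apply hz.ne, resB_apply hw.ne,
      halfRes_of_re_neg hz, halfRes_of_re_neg hw]
    rw [expConv_congr t.coe_nonneg e, expConv_smul, expConv_expConv hne (continuous_extend φ) t.coe_nonneg,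
      neg_one_smul, neg_neg, smul_smul, ← neg_sub z w, neg_mul,
      mul_inv_cancel₀ (sub_ne_zero.2 hne)]
    module

/-- Needed to integrate in `x` with values in `BUC`: strong measurability is with respect to the sup
norm, so pointwise continuity would not suffice. It follows from the resolvent identity `resB_resB`.
-/
theorem continuousOn_resB_neg (φ : BUC X) :
    ContinuousOn (fun x : ℝ => resB X (-(x : ℂ)) φ) (Ioi 0) := by
  intro y hy
  refine ContinuousAt.continuousWithinAt ?_
  have hy : 0 < y := hy
  rw [ContinuousAt, tendsto_iff_norm_sub_tendsto_zero]
  have h1 : Tendsto (fun x : ℝ => |x - y| * (x⁻¹ * (y⁻¹ * ‖φ‖))) (𝓝 y) (𝓝 0) := by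
    have h2 : ContinuousAt (fun x : ℝ => |x - y| * (x⁻¹ * (y⁻¹ * ‖φ‖))) y :=
      ContinuousAt.mul (by fun_prop) ((continuousAt_inv₀ hy.ne').mul continuousAt_const)
    simpa [ContinuousAt] using h2
  refine squeeze_zero' (Eventually.of_forall fun _ => norm_nonneg _) ?_ h1
  filter_upwards [lt_mem_nhds hy] with x hx
  have hn : ∀ x : ℝ, 0 < x → ∀ ψ : BUC X, ‖resB X (-(x : ℂ)) ψ‖ ≤ x⁻¹ * ‖ψ‖ := by
    intro x hx ψ
    refine ((resB X (-(x : ℂ))).le_opNorm ψ).trans ?_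
    have := norm_resB_le (X := X) (-(x : ℂ))
    simp only [neg_re, ofReal_re, abs_neg, abs_of_pos hx] at this
    gcongr
  rw [resB_resB (by simpa) (by simpa), norm_smul]
  have e : ‖(-(y : ℂ)) - -(x : ℂ)‖ = |x - y| := by
    rw [neg_sub_neg, ← ofReal_sub, norm_real, Real.norm_eq_abs]
  rw [e]
  gcongr
  exact (hn x hx _).trans (by gcongr; exact hn y hy φ)

/-- The action of `fracKer` on `BUC`. -/
noncomputable def fracB (α : ℝ) (z : ℂ) (φ : BUC X) : BUC X :=
  -- The minus sign turns `resB` at `-x` into convolution with `e ^ (-x t)`. Integrating inside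
  -- `BUC` gives uniform continuity of the result for free.
  if α < 1 then (balakrishnanConst α : ℂ) •
    ∫ x in Ioi (0 : ℝ), ((x : ℂ) + z)⁻¹ • (((x ^ α : ℝ) : ℂ) • -resB X (-(x : ℂ)) φ)
  else φ

theorem norm_rpow_smul_resB_le (α : ℝ) (φ : BUC X) {x : ℝ} (hx : 0 < x) :
    ‖((x ^ α : ℝ) : ℂ) • -resB X (-(x : ℂ)) φ‖ ≤ ‖φ‖ * x ^ (α - 1) := by
  have h := (resB X (-(x : ℂ))).le_of_opNorm_le (norm_resB_le _) φ
  simp only [neg_re, ofReal_re, abs_neg, abs_of_pos hx] at h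
  rw [norm_smul, norm_neg, norm_real, Real.norm_of_nonneg (by positivity),
    Real.rpow_sub_one hx.ne']
  calc _ ≤ x ^ α * (x⁻¹ * ‖φ‖) := by gcongr
    _ = _ := by ring

theorem aestronglyMeasurable_rpow_smul_resB (α : ℝ) (φ : BUC X) :
    AEStronglyMeasurable (fun x : ℝ => ((x ^ α : ℝ) : ℂ) • -resB X (-(x : ℂ)) φ)
      (volume.restrict (Ioi 0)) := by
  have h : Measurable fun x : ℝ => ((x ^ α : ℝ) : ℂ) := by fun_prop
  exact h.aestronglyMeasurable.smul
    ((continuousOn_resB_neg φ).aestronglyMeasurable measurableSet_Ioi).neg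

theorem analyticOnNhd_fracB {α : ℝ} (h0 : 0 < α) (φ : BUC X) :
    AnalyticOnNhd ℂ (fun z => fracB α z φ) slitPlane := by
  unfold fracB
  split_ifs with h1
  · exact analyticOnNhd_const.smul (analyticOnNhd_stieltjes h0 h1
      (aestronglyMeasurable_rpow_smul_resB α φ) fun x hx => norm_rpow_smul_resB_le α φ hx)
  · exact analyticOnNhd_const

theorem fracB_apply {α : ℝ} (h0 : 0 < α) {z : ℂ} (hz : z ∈ slitPlane) (φ : BUC X) (t : ℝ≥0) :
    fracB α z φ t = fracKer α z (extend φ) t := by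
  unfold fracB fracKer
  split_ifs with h1
  · rw [BUC.smul_apply, Complex.coe_smul, ← BUC.eval_apply, ← ContinuousLinearMap.integral_comp_comm _
      (integrableOn_stieltjes h0 h1 (aestronglyMeasurable_rpow_smul_resB α φ)
        (fun x hx => norm_rpow_smul_resB_le α φ hx) hz)]
    congr 1
    refine setIntegral_congr_fun measurableSet_Ioi fun x hx => ?_
    have hx : 0 < x := hx
    have hn : (-(x : ℂ)).re < 0 := by simpa
    simp only [BUC.eval_apply, BUC.smul_apply, BUC.neg_apply, resB_apply hn.ne,
      halfRes_of_re_neg hn, neg_neg, Complex.coe_smul]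
  · rw [extend_coe]

/-- At a positive real point the norm bound on the integrand is again Balakrishnan's integral, so
the constants cancel. The growth `r ^ (α - 1)` is what controls the origin later. -/
theorem norm_fracB_le {α : ℝ} (h0 : 0 < α) (h1 : α ≤ 1) {r : ℝ} (hr : 0 < r) (φ : BUC X) :
    ‖fracB α r φ‖ ≤ r ^ (α - 1) * ‖φ‖ := by
  rcases h1.lt_or_eq with h1 | rfl
  · have hc := balakrishnanConst_pos h0 h1
    have hI := integral_rpow_div_add h0 h1 hr
    have hi : IntegrableOn (fun x : ℝ => x ^ (α - 1) / (x + r)) (Ioi 0) := by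
      refine Integrable.of_integral_ne_zero ?_
      rw [hI]
      have : 0 < 1 - α := by linarith
      positivity
    rw [fracB, if_pos h1, norm_smul, norm_real, Real.norm_of_nonneg hc.le]
    have h2 : ‖∫ x in Ioi (0 : ℝ), ((x : ℂ) + r)⁻¹ • (((x ^ α : ℝ) : ℂ) • -resB X (-(x : ℂ)) φ)‖
        ≤ ∫ x in Ioi (0 : ℝ), x ^ (α - 1) / (x + r) * ‖φ‖ := by
      refine norm_integral_le_of_norm_le (hi.mul_const _) ?_
      refine (ae_restrict_mem measurableSet_Ioi).mono fun x hx => ?_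
      have hx : 0 < x := hx
      rw [norm_smul, norm_inv, ← ofReal_add, norm_real, Real.norm_of_nonneg (by positivity)]
      calc _ ≤ (x + r)⁻¹ * (‖φ‖ * x ^ (α - 1)) := by
            gcongr
            exact norm_rpow_smul_resB_le α φ hx
        _ = _ := by ring
    rw [integral_mul_const, hI] at h2
    calc _ ≤ balakrishnanConst α * (Real.Gamma α * Real.Gamma (1 - α) * r ^ (α - 1) * ‖φ‖) := by
          gcongr
      _ = (balakrishnanConst α * (balakrishnanConst α)⁻¹) * (r ^ (α - 1) * ‖φ‖) := by
          rw [balakrishnanConst, inv_inv]; ring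
      _ = _ := by rw [mul_inv_cancel₀ hc.ne', one_mul]
  · simp [fracB]

theorem resY_const {z : ℂ} (hz : z.re ≠ 0) (x : X) :
    resY X z (cls X (BUC.const x)) = z⁻¹ • cls X (BUC.const x) := by
  have hz0 : z ≠ 0 := by rintro rfl; simp at hz
  have h : IsDeriv (BUC.const x) (0 : BUC X) := fun t => hasDerivWithinAt_const (t : ℝ) _ x
  have h1 := (isResolvent_resY hz).apply_graph
    (mem_derivTilde_graph_iff.2 ⟨BUC.const x, 0, h, rfl⟩)
  rw [map_zero, sub_zero, map_smul] at h1
  rw [eq_inv_smul_iff₀ hz0]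
  exact h1

/-- The central formula: it locates the singularities of the local resolvent of `u`, since
everything on the right is governed by `A`, by `f`, or by powers of `z`. -/
theorem resY_eq_of_mild {A : X →ₗ.[ℂ] X} {α : ℝ} (h0 : 0 < α) (h1 : α ≤ 1) {f u : BUC X}
    (h : IsAsymptoticMildSolution A α f u) {z : ℂ} (hz : z ∈ slitPlane) (hre : z.re ≠ 0)
    {R : X →L[ℂ] X} (hR : IsResolvent A (z ^ (α : ℂ)) R) :
    resY X z (cls X u) = compY X R (resY X z (cls X f)
      + (cls X (fracB α z (u - BUC.const (u 0))) + z ^ ((α : ℂ) - 1) • cls X (BUC.const (u 0)))) := by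
  obtain ⟨ε, hε, -, hu⟩ := h
  set x := u 0 with hx
  set w := z ^ (α : ℂ) with hw
  have hz0 : z ≠ 0 := slitPlane_ne_zero hz
  have hmild : ∀ t, 0 ≤ t → rlInt α (extend u) t
      = R (w • rlInt α (extend u) t - (extend u t - x) + rlInt α (extend (f + ε)) t) := by
    intro t ht
    obtain ⟨hmem, e⟩ := hu t.toNNReal
    have e1 : fracInt α (fun t => u t) t.toNNReal = rlInt α (extend u) t := by
      rw [rlInt_eq_integral h0 _ ht, fracInt, Real.coe_toNNReal t ht]
      rfl
    have e2 : fracInt α (fun t => f t + ε t) t.toNNReal = rlInt α (extend (f + ε)) t := by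
      rw [rlInt_eq_integral h0 _ ht, fracInt, Real.coe_toNNReal t ht]
      rfl
    have h2 := hR.apply_graph (A.mem_graph ⟨_, hmem⟩)
    rw [e2] at e
    simp only [e1] at e h2
    rw [← h2]
    congr 1
    rw [h2, show extend u t = _ from e]
    abel
  have hexp := fun t : ℝ≥0 => expConv_eq_of_mild h0 h1 hz R (continuous_extend u)
    (continuous_extend (f + ε)) x hmild t.coe_nonneg
  -- By `hexp` all convolution parts cancel; only the Laplace terms survive, as one vector times `e
  -- ^ (z t)`.
  have hC0 : resB X z u - BUC.comp R (resB X z (f + ε) + fracB α z (u - BUC.const x)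
      + w • resB X z (BUC.const x)) ∈ C0 X := by
    refine mem_C0_of_eq_exp_smul hre (x := laplace z (extend u)
      - R (laplace z (extend (f + ε)) + w • laplace z (fun _ => x))) fun t => ?_
    have ec : extend (BUC.const x) = fun _ => x := rfl
    have ed : extend (u - BUC.const x) = fun s => extend u s - x := rfl
    simp only [BUC.sub_apply, BUC.comp_apply, BUC.add_apply, BUC.smul_apply, resB_apply hre,
      fracB_apply h0 hz, halfRes, ec, ed]
    rw [hexp t]
    simp only [map_add, map_sub, map_smul]
    module
  have hf : cls X (f + ε) = cls X f := by
    rw [map_add, (cls_eq_zero_iff ε).2 hε, add_zero]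
  rw [← cls_eq_cls_iff, ← compY_cls, map_add (cls X), map_add (cls X), map_smul (cls X),
    ← resY_cls, ← resY_cls, ← resY_cls, hf, resY_const hre, smul_smul] at hC0
  rw [hC0, cpow_sub _ _ hz0, cpow_one, add_assoc, div_eq_mul_inv]

end

section

variable {E : Type*} [NormedAddCommGroup E] [NormedSpace ℂ E]

/-! ### Analytic extension across the imaginary axis -/

/-- `F`, considered off the imaginary axis, has an analytic extension near `z₀`. -/
def ExtendsAt (F : ℂ → E) (z₀ : ℂ) : Prop :=
  ∃ G : ℂ → E, AnalyticAt ℂ G z₀ ∧ ∀ᶠ z in 𝓝 z₀, z.re ≠ 0 → G z = F z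

theorem ExtendsAt.of_analyticAt {F : ℂ → E} {z₀ : ℂ} (h : AnalyticAt ℂ F z₀) : ExtendsAt F z₀ :=
  ⟨F, h, Eventually.of_forall fun _ _ => rfl⟩

theorem closure_re_ne_zero : closure {z : ℂ | z.re ≠ 0} = univ := by
  have h : {z : ℂ | z.re ≠ 0} = re ⁻¹' {0}ᶜ := rfl
  rw [h, Complex.closure_preimage_re, closure_compl_singleton, preimage_univ]

/-- The extension by continuity of a function defined off the imaginary axis. -/
noncomputable def acrossAxis (F : ℂ → E) : ℂ → E := extendFrom {z : ℂ | z.re ≠ 0} F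

theorem ExtendsAt.clm {E' : Type*} [NormedAddCommGroup E'] [NormedSpace ℂ E'] {F : ℂ → E} {z₀ : ℂ}
    (h : ExtendsAt F z₀) (T : E →L[ℂ] E') : ExtendsAt (fun z => T (F z)) z₀ := by
  obtain ⟨G, hG, h⟩ := h
  exact ⟨fun z => T (G z), (T.analyticAt _).comp hG, h.mono fun z hz h => by simp only [hz h]⟩

theorem ExtendsAt.smul {F : ℂ → E} {z₀ : ℂ} (h : ExtendsAt F z₀) {g : ℂ → ℂ}
    (hg : AnalyticAt ℂ g z₀) : ExtendsAt (fun z => g z • F z) z₀ := by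
  obtain ⟨G, hG, h⟩ := h
  exact ⟨fun z => g z • G z, hg.smul hG, h.mono fun z hz h => by simp only [hz h]⟩

/-- Levinson's factor: on the circle `r ^ 2 = z * conj z`, so it equals `2 re z / conj z`. Its zeros
on the axis compensate a bound of order `1 / |re z|`. -/
theorem norm_one_add_sq_div_sq {z : ℂ} {r : ℝ} (hr : 0 < r) (hz : ‖z‖ = r) :
    ‖1 + z ^ 2 / (r : ℂ) ^ 2‖ = 2 * |z.re| / r := by
  have hz0 : z ≠ 0 := norm_pos_iff.1 (hz ▸ hr)
  have hc : (starRingEnd ℂ) z ≠ 0 := (map_ne_zero _).2 hz0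
  have h1 : (r : ℂ) ^ 2 = z * (starRingEnd ℂ) z := by
    rw [Complex.mul_conj, Complex.normSq_eq_norm_sq, hz]
    push_cast
    rfl
  have h2 : 1 + z ^ 2 / (r : ℂ) ^ 2 = (2 * z.re : ℝ) / (starRingEnd ℂ) z := by
    rw [h1, ← Complex.add_conj]
    field_simp
    ring
  rw [h2, norm_div, Complex.norm_conj, hz, norm_real, Real.norm_eq_abs, abs_mul, abs_two]

theorem norm_one_add_sq_div_sq' {z : ℂ} {r : ℝ} (hr : 0 < r) (hz : ‖z‖ = r) :
    ‖1 + (r : ℂ) ^ 2 / z ^ 2‖ = 2 * |z.re| / r := by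
  have hz0 : z ≠ 0 := norm_pos_iff.1 (hz ▸ hr)
  have hr0 : (r : ℂ) ≠ 0 := by exact_mod_cast hr.ne'
  have h : 1 + (r : ℂ) ^ 2 / z ^ 2 = (r : ℂ) ^ 2 / z ^ 2 * (1 + z ^ 2 / (r : ℂ) ^ 2) := by
    field_simp
    ring
  rw [h, norm_mul, norm_one_add_sq_div_sq hr hz, norm_div, norm_pow, norm_pow, hz, norm_real,
    Real.norm_of_nonneg hr.le, div_self (by positivity), one_mul]

theorem three_quarters_le_norm_one_add {w : ℂ} (hw : ‖w‖ ≤ 1 / 4) : 3 / 4 ≤ ‖1 + w‖ := by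
  have := norm_sub_le_norm_add (1 : ℂ) w
  rw [norm_one] at this
  linarith

variable [CompleteSpace E]

theorem ExtendsAt.eventuallyEq {F : ℂ → E} {z₀ : ℂ} {G : ℂ → E} (hG : AnalyticAt ℂ G z₀)
    (h : ∀ᶠ z in 𝓝 z₀, z.re ≠ 0 → G z = F z) : acrossAxis F =ᶠ[𝓝 z₀] G := by
  filter_upwards [hG.eventually_analyticAt, h.eventually_nhds] with z h1 h2
  refine extendFrom_eq (by rw [closure_re_ne_zero]; trivial) ?_
  refine (h1.continuousAt.mono_left nhdsWithin_le_nhds).congr' ?_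
  filter_upwards [nhdsWithin_le_nhds h2, self_mem_nhdsWithin] with w hw hw'
  exact hw hw'

theorem ExtendsAt.analyticAt {F : ℂ → E} {z₀ : ℂ} (h : ExtendsAt F z₀) :
    AnalyticAt ℂ (acrossAxis F) z₀ := by
  obtain ⟨G, hG, h⟩ := h
  exact hG.congr (ExtendsAt.eventuallyEq hG h).symm

theorem ExtendsAt.acrossAxis_eq {F : ℂ → E} {z₀ : ℂ} (h : ExtendsAt F z₀) (hz : z₀.re ≠ 0) :
    acrossAxis F z₀ = F z₀ := by
  obtain ⟨G, hG, h⟩ := h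
  exact (ExtendsAt.eventuallyEq hG h).self_of_nhds.trans (h.self_of_nhds hz)

/-- Maximum principle on an annulus whose inner radius is half the distance from `z` to `z₀`.
Multiplying by a Levinson factor for each boundary circle gives at most `4 * C` there; at `z` each
factor is at least `3 / 4`, whence `16 / 9`. -/
theorem norm_le_of_norm_le_div_re {F : ℂ → E} {z₀ : ℂ} (h0 : z₀.re = 0) {C ρ : ℝ} (hC : 0 ≤ C)
    (hext : ∀ z, z ≠ z₀ → ‖z - z₀‖ ≤ ρ → ExtendsAt F z)
    (hbd : ∀ z, ‖z - z₀‖ ≤ ρ → z.re ≠ 0 → ‖F z‖ ≤ C * (‖z - z₀‖ / |z.re|)) {z : ℂ}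
    (hz : z ≠ z₀) (hzρ : ‖z - z₀‖ ≤ ρ / 2) : ‖acrossAxis F z‖ ≤ 4 * C * (16 / 9) := by
  have hζ : 0 < ‖z - z₀‖ := norm_pos_iff.2 (sub_ne_zero.2 hz)
  have hρ : 0 < ρ := by linarith
  set r : ℝ := ‖z - z₀‖ / 2 with hr
  have hr0 : 0 < r := by positivity
  have hrρ : r ≤ ρ := by linarith
  set U : Set ℂ := {w | r < ‖w - z₀‖ ∧ ‖w - z₀‖ < ρ} with hU
  have hcont : Continuous fun w : ℂ => ‖w - z₀‖ := by fun_prop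
  have hUo : IsOpen U :=
    (isOpen_lt continuous_const hcont).and (isOpen_lt hcont continuous_const)
  have hUc : closure U ⊆ {w | r ≤ ‖w - z₀‖ ∧ ‖w - z₀‖ ≤ ρ} := by
    refine closure_minimal (fun w hw => ⟨hw.1.le, hw.2.le⟩) ?_
    exact (isClosed_le continuous_const hcont).and (isClosed_le hcont continuous_const)
  have hne : ∀ w, r ≤ ‖w - z₀‖ → w - z₀ ≠ 0 := fun w hw => norm_pos_iff.1 (hr0.trans_le hw)
  set H : ℂ → E := fun w =>
    ((1 + (r : ℂ) ^ 2 / (w - z₀) ^ 2) * (1 + (w - z₀) ^ 2 / (ρ : ℂ) ^ 2)) • acrossAxis F w with hH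
  have hd : DiffContOnCl ℂ H U := by
    refine DifferentiableOn.diffContOnCl fun w hw => ?_
    have hw := hUc hw
    have h1 := hne w hw.1
    have h2 := (hext w (sub_ne_zero.1 h1) hw.2).analyticAt.differentiableAt
    refine DifferentiableAt.differentiableWithinAt (DifferentiableAt.smul ?_ h2)
    have h3 : (w - z₀) ^ 2 ≠ 0 := pow_ne_zero 2 h1
    fun_prop (disch := assumption)
  -- In product form the bound is trivial on the axis, so boundary points there need no limiting
  -- argument.
  have hval : ∀ w, w ≠ z₀ → ‖w - z₀‖ ≤ ρ → |w.re| * ‖acrossAxis F w‖ ≤ C * ‖w - z₀‖ := by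
    intro w hw hwρ
    by_cases hre : w.re = 0
    · rw [hre, abs_zero, zero_mul]
      positivity
    · rw [(hext w hw hwρ).acrossAxis_eq hre]
      have hp : 0 < |w.re| := abs_pos.2 hre
      calc _ ≤ |w.re| * (C * (‖w - z₀‖ / |w.re|)) := by
            gcongr
            exact hbd w hwρ hre
        _ = _ := by field_simp
  have hle : ∀ {a : ℂ}, ‖a‖ ≤ 1 → ‖1 + a‖ ≤ 2 := by
    intro a ha
    have := norm_add_le (1 : ℂ) a
    rw [norm_one] at this
    linarith
  have hfr : ∀ w ∈ frontier U, ‖H w‖ ≤ 4 * C := by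
    intro w hw
    have hwc := hUc hw.1
    have hwU : w ∉ U := by
      have := hw.2
      rwa [hUo.interior_eq] at this
    have h1 := hne w hwc.1
    have hv := hval w (sub_ne_zero.1 h1) hwc.2
    have hre : (w - z₀).re = w.re := by rw [sub_re, h0, sub_zero]
    rw [hH]
    simp only
    rw [norm_smul, norm_mul]
    by_cases hwr : ‖w - z₀‖ = r
    · rw [norm_one_add_sq_div_sq' hr0 hwr, hre]
      have h3 : ‖1 + (w - z₀) ^ 2 / (ρ : ℂ) ^ 2‖ ≤ 2 := by
        refine hle ?_
        rw [norm_div, norm_pow, norm_pow, norm_real, Real.norm_of_nonneg hρ.le,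
          div_le_one (by positivity)]
        gcongr
        exact hwc.2
      rw [hwr] at hv
      calc _ ≤ 2 * |w.re| / r * 2 * ‖acrossAxis F w‖ := by gcongr
        _ = 4 * (|w.re| * ‖acrossAxis F w‖) / r := by ring
        _ ≤ 4 * (C * r) / r := by gcongr
        _ = _ := by field_simp
    · have hwρ : ‖w - z₀‖ = ρ := by
        refine le_antisymm hwc.2 (not_lt.1 fun h => hwU ⟨lt_of_le_of_ne hwc.1 (Ne.symm hwr), h⟩)
      rw [norm_one_add_sq_div_sq hρ hwρ, hre]
      have h3 : ‖1 + (r : ℂ) ^ 2 / (w - z₀) ^ 2‖ ≤ 2 := by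
        refine hle ?_
        rw [norm_div, norm_pow, norm_pow, norm_real, Real.norm_of_nonneg hr0.le,
          div_le_one (by positivity)]
        gcongr
        exact hwc.1
      rw [hwρ] at hv
      calc _ ≤ 2 * (2 * |w.re| / ρ) * ‖acrossAxis F w‖ := by gcongr
        _ = 4 * (|w.re| * ‖acrossAxis F w‖) / ρ := by ring
        _ ≤ 4 * (C * ρ) / ρ := by gcongr
        _ = _ := by field_simp
  have hb : Bornology.IsBounded U := Metric.isBounded_ball.subset fun w hw => by
    rw [Metric.mem_ball, dist_eq_norm]
    exact hw.2
  have hzU : z ∈ U := ⟨by linarith, by linarith⟩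
  have hfin := Complex.norm_le_of_forall_mem_frontier_norm_le hb hd hfr (subset_closure hzU)
  rw [hH] at hfin
  simp only at hfin
  rw [norm_smul, norm_mul] at hfin
  have a1 : 3 / 4 ≤ ‖1 + (r : ℂ) ^ 2 / (z - z₀) ^ 2‖ := by
    refine three_quarters_le_norm_one_add ?_
    rw [norm_div, norm_pow, norm_pow, norm_real, Real.norm_of_nonneg hr0.le, hr, div_pow,
      div_div_cancel_left' (by positivity)]
    norm_num
  have a2 : 3 / 4 ≤ ‖1 + (z - z₀) ^ 2 / (ρ : ℂ) ^ 2‖ := by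
    refine three_quarters_le_norm_one_add ?_
    rw [norm_div, norm_pow, norm_pow, norm_real, Real.norm_of_nonneg hρ.le,
      div_le_iff₀ (by positivity)]
    calc ‖z - z₀‖ ^ 2 ≤ (ρ / 2) ^ 2 := by gcongr
      _ = _ := by ring
  have a3 : 3 / 4 * (3 / 4) * ‖acrossAxis F z‖ ≤ 4 * C := le_trans (by gcongr) hfin
  linarith

/-- An isolated singularity on the imaginary axis with a bound of type `|z - z₀| / |re z|` is
removable. -/
theorem ExtendsAt.of_isolated {F : ℂ → E} {z₀ : ℂ} (h0 : z₀.re = 0) {C : ℝ}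
    (hC : 0 ≤ C) (hext : ∀ᶠ z in 𝓝[≠] z₀, ExtendsAt F z)
    (hbd : ∀ᶠ z in 𝓝 z₀, z.re ≠ 0 → ‖F z‖ ≤ C * (‖z - z₀‖ / |z.re|)) : ExtendsAt F z₀ := by
  obtain ⟨ρ, hρ, h⟩ := Metric.eventually_nhds_iff_ball.1 ((eventually_nhdsWithin_iff.1 hext).and hbd)
  have h1 : ∀ z, ‖z - z₀‖ ≤ ρ / 2 → z ∈ Metric.ball z₀ ρ := by
    intro z hz
    rw [Metric.mem_ball, dist_eq_norm]
    linarith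
  have hs : Metric.ball z₀ (ρ / 2 / 2) ∈ 𝓝 z₀ := Metric.ball_mem_nhds _ (by positivity)
  have hball : ∀ z ∈ Metric.ball z₀ (ρ / 2 / 2), ‖z - z₀‖ ≤ ρ / 2 / 2 := by
    intro z hz
    rw [Metric.mem_ball, dist_eq_norm] at hz
    exact hz.le
  have hd := Complex.differentiableOn_update_limUnder_of_bddAbove (f := acrossAxis F) hs
    (fun z hz => ((h z (h1 z (by linarith [hball z hz.1]))).1
      hz.2).analyticAt.differentiableAt.differentiableWithinAt)
    ⟨4 * C * (16 / 9), by
      rintro _ ⟨z, hz, rfl⟩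
      exact norm_le_of_norm_le_div_re h0 hC (fun w hw hwρ => (h w (h1 w hwρ)).1 hw)
        (fun w hwρ => (h w (h1 w hwρ)).2) hz.2 (hball z hz.1)⟩
  refine ⟨_, hd.analyticAt hs, ?_⟩
  filter_upwards [hs] with z hz hre
  have hne : z ≠ z₀ := by
    rintro rfl
    exact hre h0
  rw [Function.update_of_ne hne]
  exact ((h z (h1 z (by linarith [hball z hz]))).1 hne).acrossAxis_eq hre

/-- Liouville with Levinson's factor: on the circle of radius `R` the product is at most `2 * C /
R`, while at the fixed point `z` the factor stays at least `3 / 4`. Let `R → ∞`. -/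
theorem eq_zero_of_extendsAt {F : ℂ → E} {C : ℝ} (hC : 0 ≤ C) (hext : ∀ z, ExtendsAt F z)
    (hbd : ∀ z, z.re ≠ 0 → ‖F z‖ ≤ C / |z.re|) {z : ℂ} (hz : z.re ≠ 0) : F z = 0 := by
  have hval : ∀ w, |w.re| * ‖acrossAxis F w‖ ≤ C := by
    intro w
    by_cases hre : w.re = 0
    · rw [hre, abs_zero, zero_mul]
      exact hC
    · rw [(hext w).acrossAxis_eq hre, mul_comm, ← le_div_iff₀ (abs_pos.2 hre)]
      exact hbd w hre
  have hR : ∀ R : ℝ, 2 * ‖z‖ + 1 ≤ R → 3 / 4 * ‖acrossAxis F z‖ ≤ 2 * C / R := by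
    intro R hR
    have hz0 := norm_nonneg z
    have hR0 : 0 < R := by linarith
    have hd : DiffContOnCl ℂ (fun w : ℂ => (1 + w ^ 2 / (R : ℂ) ^ 2) • acrossAxis F w)
        (Metric.ball 0 R) := by
      refine DifferentiableOn.diffContOnCl fun w _ => ?_
      refine DifferentiableAt.differentiableWithinAt (DifferentiableAt.smul ?_
        (hext w).analyticAt.differentiableAt)
      fun_prop
    have h := Complex.norm_le_of_forall_mem_frontier_norm_le (C := 2 * C / R)
      Metric.isBounded_ball hd (fun w hw => by
        rw [frontier_ball _ hR0.ne', mem_sphere_zero_iff_norm] at hw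
        rw [norm_smul, norm_one_add_sq_div_sq hR0 hw]
        calc _ = 2 * (|w.re| * ‖acrossAxis F w‖) / R := by ring
          _ ≤ _ := by
            gcongr
            exact hval w)
      (subset_closure (mem_ball_zero_iff.2 (by linarith) : z ∈ Metric.ball 0 R))
    rw [norm_smul] at h
    refine le_trans ?_ h
    gcongr
    refine three_quarters_le_norm_one_add ?_
    rw [norm_div, norm_pow, norm_pow, norm_real, Real.norm_of_nonneg hR0.le,
      div_le_iff₀ (by positivity)]
    calc ‖z‖ ^ 2 ≤ (R / 2) ^ 2 := by gcongr; linarith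
      _ = _ := by ring
  have hlim : Tendsto (fun R : ℝ => 2 * C / R) atTop (𝓝 0) := tendsto_const_nhds.div_atTop tendsto_id
  have h2 : 3 / 4 * ‖acrossAxis F z‖ ≤ 0 :=
    ge_of_tendsto hlim ((eventually_ge_atTop _).mono hR)
  rw [← (hext z).acrossAxis_eq hz]
  exact norm_le_zero_iff.1 (by linarith)

end

section

variable {X : Type*} [NormedAddCommGroup X] [NormedSpace ℂ X]

/-! ### The translation on the quotient -/

theorem norm_expConv_one_le (z : ℂ) {φ : ℝ → X} {M : ℝ} (hM : ∀ s, ‖φ s‖ ≤ M) :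
    ‖expConv z φ 1‖ ≤ Real.exp ‖z‖ * M := by
  have hM0 : 0 ≤ M := (norm_nonneg _).trans (hM 0)
  have h := intervalIntegral.norm_integral_le_of_norm_le_const (a := 0) (b := 1)
    (C := Real.exp ‖z‖ * M) (f := fun s : ℝ => cexp (z * ((1 : ℝ) - s)) • φ s) (fun s hs => by
      rw [uIoc_of_le zero_le_one] at hs
      rw [norm_smul, Complex.norm_exp, ← ofReal_sub, re_mul_ofReal]
      have h1 : z.re * (1 - s) ≤ ‖z‖ := by
        have h2 := Complex.re_le_norm z
        have h3 := norm_nonneg z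
        nlinarith [hs.1, hs.2]
      gcongr
      exact hM s)
  simpa [expConv] using h

variable (X) in
/-- The operator induced on the quotient by `φ ↦ φ(· + 1) - c φ`. -/
noncomputable def shiftSub (c : ℂ) : Y X →L[ℂ] Y X :=
  descend BUC.shift BUC.shift_mem_C0 - c • ContinuousLinearMap.id ℂ (Y X)

theorem shiftSub_cls (c : ℂ) (φ : BUC X) :
    shiftSub X c (cls X φ) = cls X (BUC.shift φ - c • φ) := by
  rw [map_sub, map_smul]
  rfl

/-- Analyticity is known only off the slit, so boundedness at the origin is drawn from `R = R₀ - z₀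
R R₀`, absorbing the last term once `‖z₀‖ * ‖R₀‖ ≤ 1 / 2`. -/
theorem eventually_norm_le_two_mul {A : X →ₗ.[ℂ] X} {z₀ : ℝ → ℂ} {R : ℝ → X →L[ℂ] X} {R₀ : X →L[ℂ] X}
    {l : Filter ℝ} (hz : Tendsto z₀ l (𝓝 0)) (hR₀ : IsResolvent A 0 R₀)
    (hR : ∀ᶠ x in l, IsResolvent A (z₀ x) (R x)) : ∀ᶠ x in l, ‖R x‖ ≤ 2 * ‖R₀‖ := by
  have h1 : Tendsto (fun x => ‖z₀ x‖ * ‖R₀‖) l (𝓝 0) := by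
    simpa using hz.norm.mul_const ‖R₀‖
  filter_upwards [hR, h1.eventually_le_const (by norm_num : (0 : ℝ) < 1 / 2)] with x hx hs
  have h2 : R x = R₀ + (0 - z₀ x) • (R x ∘L R₀) := by
    rw [← hx.sub_apply hR₀]
    abel
  have h3 : ‖R x‖ ≤ ‖R₀‖ + ‖z₀ x‖ * (‖R x‖ * ‖R₀‖) := by
    calc ‖R x‖ = ‖R₀ + (0 - z₀ x) • (R x ∘L R₀)‖ := by rw [← h2]
      _ ≤ ‖R₀‖ + ‖(0 - z₀ x) • (R x ∘L R₀)‖ := norm_add_le _ _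
      _ ≤ _ := by
        rw [norm_smul, zero_sub, norm_neg]
        gcongr
        exact ContinuousLinearMap.opNorm_comp_le _ _
  have h4 := norm_nonneg (R x)
  nlinarith

variable [CompleteSpace X]

theorem resB_shift_sub_mem_C0 {z : ℂ} (hz : z.re ≠ 0) (φ : BUC X) :
    resB X z (BUC.shift φ) - BUC.shift (resB X z φ) ∈ C0 X := by
  refine mem_C0_of_isDeriv_smul hz ?_
  have h1 : IsDeriv (BUC.shift (resB X z φ)) (z • BUC.shift (resB X z φ) - BUC.shift φ) := by
    refine isDeriv_of_hasDerivAt (w := fun s => halfRes z (extend φ) (s + 1)) (fun t => ?_)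
      fun t => ?_
    · rw [BUC.shift_apply, resB_apply hz]
      push_cast
      rfl
    · refine ((hasDerivAt_halfRes z (continuous_extend φ) (t + 1)).comp_add_const _ _).congr_deriv
        ?_
      rw [BUC.sub_apply, BUC.smul_apply, BUC.shift_apply, BUC.shift_apply, resB_apply hz,
        ← extend_coe φ (t + 1)]
      push_cast
      rfl
  have h2 := (derivGraph X).sub_mem ((mem_derivGraph (_, _)).2 (isDeriv_resB hz (BUC.shift φ)))
    ((mem_derivGraph (_, _)).2 h1)
  have e : z • resB X z (BUC.shift φ) - BUC.shift φ - (z • BUC.shift (resB X z φ) - BUC.shift φ)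
      = z • (resB X z (BUC.shift φ) - BUC.shift (resB X z φ)) := by module
  rw [Prod.mk_sub_mk, e] at h2
  exact h2

theorem resY_shiftSub {z : ℂ} (hz : z.re ≠ 0) (c : ℂ) (y : Y X) :
    resY X z (shiftSub X c y) = shiftSub X c (resY X z y) := by
  obtain ⟨φ, rfl⟩ := exists_cls_eq y
  rw [shiftSub_cls, resY_cls, resY_cls, shiftSub_cls, cls_eq_cls_iff, map_sub, map_smul]
  have h := resB_shift_sub_mem_C0 hz φ
  convert h using 1
  abel

/-- Replacing `c` by `e ^ z` leaves minus an exponential convolution over a unit interval, bounded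
without any `1 / |re z|`. The singular part therefore carries the factor `e ^ z - c`. -/
theorem norm_resY_shiftSub_le {z : ℂ} (hz : z.re ≠ 0) (c : ℂ) (φ : BUC X) :
    ‖resY X z (shiftSub X c (cls X φ))‖
      ≤ ‖cexp z - c‖ * (‖φ‖ / |z.re|) + Real.exp ‖z‖ * ‖φ‖ := by
  have h1 : BUC.shift (resB X z φ) - c • resB X z φ = (cexp z - c) • resB X z φ
      + (BUC.shift (resB X z φ) - cexp z • resB X z φ) := by module
  have h2 : ‖BUC.shift (resB X z φ) - cexp z • resB X z φ‖ ≤ Real.exp ‖z‖ * ‖φ‖ := by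
    refine BUC.norm_le (by positivity) fun t => ?_
    have h3 := expConv_add_right z (continuous_extend φ) t zero_le_one
    have h4 : (BUC.shift (resB X z φ) - cexp z • resB X z φ) t
        = -expConv z (fun s => extend φ (s + t)) 1 := by
      rw [BUC.sub_apply, BUC.smul_apply, BUC.shift_apply, resB_apply hz, resB_apply hz, halfRes,
        halfRes]
      push_cast
      rw [add_comm (t : ℝ) 1, h3, mul_add, mul_one, Complex.exp_add, ofReal_one, mul_one,
        mul_comm (cexp (z * t)), mul_smul]
      module
    rw [h4, norm_neg]
    exact norm_expConv_one_le z fun s => norm_extend_le φ _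
  rw [resY_shiftSub hz, resY_cls, shiftSub_cls, h1]
  refine (norm_cls_le _).trans ((norm_add_le _ _).trans (add_le_add ?_ h2))
  rw [norm_smul]
  gcongr
  have := (resB X z).le_of_opNorm_le (norm_resB_le z) φ
  rwa [div_eq_inv_mul]

theorem norm_resY_apply_le (z : ℂ) (y : Y X) : ‖resY X z y‖ ≤ ‖y‖ / |z.re| := by
  rw [div_eq_inv_mul]
  exact (resY X z).le_of_opNorm_le (norm_resY_le z) y

theorem eq_zero_of_resY_eq_zero {z : ℂ} (hz : z.re ≠ 0) {y : Y X} (h : resY X z y = 0) :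
    y = 0 := by
  have h1 := (isResolvent_resY hz).mem_graph y
  rw [h, smul_zero, zero_sub] at h1
  simpa using LinearPMap.graph_fst_eq_zero_snd _ h1 rfl

theorem extendsAt_resY_of_re_ne_zero {z : ℂ} (hz : z.re ≠ 0) (y : Y X) :
    ExtendsAt (fun z => resY X z y) z := by
  refine ExtendsAt.of_analyticAt ?_
  have hd : DifferentiableOn ℂ (fun z => resY X z y) {z : ℂ | z.re ≠ 0} := fun w hw =>
    ((differentiableAt_resY hw).clm_apply (differentiableAt_const y)).differentiableWithinAt
  exact hd.analyticAt ((isOpen_ne_fun continuous_re continuous_const).mem_nhds hz)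

/-! ### The local resolvent of a mild solution -/

theorem exists_analyticAt_of_notMem_sp {f : BUC X} {ξ : ℝ} (h : ξ ∉ sp f) :
    ∃ G : ℂ → Y X, AnalyticAt ℂ G (I * ξ) ∧
      ∀ᶠ z in 𝓝 (I * (ξ : ℂ)), z.re ≠ 0 → G z = resY X z (cls X f) := by
  obtain ⟨U, hU, hξ, G, hG, h⟩ := not_not.1 h
  exact ⟨G, hG _ hξ, eventually_of_mem (hU.mem_nhds hξ) fun z hz hre => h z hz _ (isResolvent_resY hre)⟩

variable {A : X →ₗ.[ℂ] X} {α : ℝ} {f u : BUC X}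

/-- For `ξ ≠ 0` the point `iξ` is interior to the slit plane, so every ingredient of
`resY_eq_of_mild` is analytic or extends analytically there. -/
theorem extendsAt_of_mild (h0 : 0 < α) (h1 : α ≤ 1) (h : IsAsymptoticMildSolution A α f u) {ξ : ℝ}
    (hξ : ξ ≠ 0) (hA : I * (ξ : ℂ) ∈ fracResolventSet A α) (hf : ξ ∉ sp f) :
    ExtendsAt (fun z => resY X z (cls X u)) (I * ξ) := by
  obtain ⟨U, hU, hUξ, R, -, hR, hRa⟩ := hA
  obtain ⟨G, hG, hGe⟩ := exists_analyticAt_of_notMem_sp hf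
  have hs : I * (ξ : ℂ) ∈ slitPlane := Or.inr (by simpa using hξ)
  refine ⟨fun z => compY X (R z) (G z + (cls X (fracB α z (u - BUC.const (u 0)))
    + z ^ ((α : ℂ) - 1) • cls X (BUC.const (u 0)))), ?_, ?_⟩
  · have a2 : AnalyticAt ℂ (fun z => cls X (fracB α z (u - BUC.const (u 0)))) (I * ξ) :=
      ((clsL X).analyticAt _).comp (analyticOnNhd_fracB h0 _ _ hs)
    have a3 : AnalyticAt ℂ (fun z : ℂ => z ^ ((α : ℂ) - 1)) (I * ξ) :=
      analyticAt_id.cpow analyticAt_const hs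
    have a4 : AnalyticAt ℂ (fun z : ℂ => z ^ ((α : ℂ) - 1) • cls X (BUC.const (u 0))) (I * ξ) :=
      a3.smul (analyticAt_const (v := cls X (BUC.const (u 0))))
    exact ((compY X).analyticAt_bilinear _).comp₂ (hRa _ ⟨hUξ, hs⟩)
      (hG.add (a2.add a4))
  · filter_upwards [hU.mem_nhds hUξ, isOpen_slitPlane.mem_nhds hs, hGe] with z hzU hzs hz hre
    rw [hz hre, resY_eq_of_mild h0 h1 h hzs hre (hR z ⟨hzU, hzs⟩)]

/-- At a point of the resolvent set that is not in the spectrum of the forcing term, the local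
resolvent at `0` grows more slowly than `1 / x`. -/
theorem tendsto_smul_resY (h0 : 0 < α) (h1 : α ≤ 1) (h : IsAsymptoticMildSolution A α f u)
    (hA : (0 : ℂ) ∈ fracResolventSet A α) (hf : (0 : ℝ) ∉ sp f) :
    Tendsto (fun x : ℝ => (x : ℂ) • resY X x (cls X u)) (𝓝[>] 0) (𝓝 0) := by
  obtain ⟨U, hU, hU0, R, hR0, hR, -⟩ := hA
  obtain ⟨G, hG, hGe⟩ := exists_analyticAt_of_notMem_sp hf
  rw [ofReal_zero, mul_zero] at hG hGe
  rw [zero_cpow (by exact_mod_cast h0.ne')] at hR0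
  have hcoe : Tendsto (fun x : ℝ => (x : ℂ)) (𝓝[>] 0) (𝓝 0) :=
    (continuous_ofReal.tendsto' 0 0 ofReal_zero).mono_left nhdsWithin_le_nhds
  have hpow : Tendsto (fun x : ℝ => x ^ α) (𝓝[>] 0) (𝓝 0) :=
    ((Real.continuous_rpow_const h0.le).tendsto' 0 0 (Real.zero_rpow h0.ne')).mono_left
      nhdsWithin_le_nhds
  have hpos : ∀ᶠ x : ℝ in 𝓝[>] 0, 0 < x := self_mem_nhdsWithin
  have hslit : ∀ x : ℝ, 0 < x → (x : ℂ) ∈ slitPlane := fun x hx => Or.inl (by simpa)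
  have hRx : ∀ᶠ x : ℝ in 𝓝[>] 0, IsResolvent A (((x ^ α : ℝ)) : ℂ) (R x) := by
    filter_upwards [hpos, hcoe.eventually (hU.mem_nhds hU0)] with x hx hxU
    have := hR x ⟨hxU, hslit x hx⟩
    rwa [← ofReal_cpow hx.le] at this
  have hRb := eventually_norm_le_two_mul
    ((continuous_ofReal.tendsto' 0 0 ofReal_zero).comp hpow) hR0 hRx
  set K : ℝ := ‖u - BUC.const (u 0)‖ + ‖cls X (BUC.const (u 0))‖ with hK
  have hb : ∀ᶠ x : ℝ in 𝓝[>] 0, ‖(x : ℂ) • resY X x (cls X u)‖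
      ≤ 2 * ‖R 0‖ * (x * ‖G x‖ + x ^ α * K) := by
    filter_upwards [hpos, hRx, hRb, hcoe.eventually hGe] with x hx h2 h3 h4
    have hre : (x : ℂ).re ≠ 0 := by simpa using hx.ne'
    have h2' : IsResolvent A ((x : ℂ) ^ (α : ℂ)) (R x) := by rwa [← ofReal_cpow hx.le]
    rw [resY_eq_of_mild h0 h1 h (hslit x hx) hre h2', ← h4 hre, norm_smul, norm_real,
      Real.norm_of_nonneg hx.le]
    have h5 : ‖compY X (R x)‖ ≤ 2 * ‖R 0‖ := by
      refine ((compY X).le_opNorm _).trans ?_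
      have h6 : ‖compY X‖ ≤ 1 := LinearMap.mkContinuous_norm_le _ zero_le_one _
      calc _ ≤ 1 * (2 * ‖R 0‖) := by gcongr
        _ = _ := one_mul _
    have h7 : ‖cls X (fracB α x (u - BUC.const (u 0))) + (x : ℂ) ^ ((α : ℂ) - 1) •
        cls X (BUC.const (u 0))‖ ≤ x ^ (α - 1) * K := by
      rw [hK, mul_add]
      refine (norm_add_le _ _).trans (add_le_add ((norm_cls_le _).trans (norm_fracB_le h0 h1 hx _))
        ?_)
      rw [norm_smul, norm_cpow_eq_rpow_re_of_pos hx]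
      simp
    calc _ ≤ x * ((2 * ‖R 0‖) * (‖G x‖ + x ^ (α - 1) * K)) := by
          gcongr
          refine (ContinuousLinearMap.le_opNorm _ _).trans ?_
          gcongr
          exact (norm_add_le _ _).trans (add_le_add le_rfl h7)
      _ = _ := by
          rw [Real.rpow_sub_one hx.ne']
          field_simp
  have hx0 : Tendsto (fun x : ℝ => x) (𝓝[>] 0) (𝓝 0) := tendsto_id.mono_left nhdsWithin_le_nhds
  have hlim : Tendsto (fun x : ℝ => 2 * ‖R 0‖ * (x * ‖G x‖ + x ^ α * K)) (𝓝[>] 0) (𝓝 0) := by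
    have := ((hx0.mul (hG.continuousAt.tendsto.comp hcoe).norm).add (hpow.mul_const K)).const_mul
      (2 * ‖R 0‖)
    simpa using this
  exact squeeze_zero_norm' hb hlim

/-- The bound `‖z û(z)‖ ≤ ‖ũ‖ |z| / |re z|` lets `z û(z)` extend to `0`; its value there, read off
along the positive reals, is `0`, so one may divide by `z`. -/
theorem extendsAt_zero_of_mild (h0 : 0 < α) (h1 : α ≤ 1) (h : IsAsymptoticMildSolution A α f u)
    (hA : (0 : ℂ) ∈ fracResolventSet A α) (hf : (0 : ℝ) ∉ sp f)
    (hext : ∀ᶠ z in 𝓝[≠] 0, ExtendsAt (fun z => resY X z (cls X u)) z) :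
    ExtendsAt (fun z => resY X z (cls X u)) 0 := by
  obtain ⟨G, hG, hGe⟩ := ExtendsAt.of_isolated (F := fun z => z • resY X z (cls X u)) (z₀ := 0)
    zero_re (norm_nonneg (cls X u)) (hext.mono fun z hz => hz.smul analyticAt_id)
    (Eventually.of_forall fun z hz => by
      rw [norm_smul, sub_zero]
      calc _ ≤ ‖z‖ * (‖cls X u‖ / |z.re|) := by
            gcongr
            exact norm_resY_apply_le z _
        _ = _ := by ring)
  have hcoe : Tendsto (fun x : ℝ => (x : ℂ)) (𝓝[>] 0) (𝓝 0) :=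
    (continuous_ofReal.tendsto' 0 0 ofReal_zero).mono_left nhdsWithin_le_nhds
  have hG0 : G 0 = 0 := by
    refine tendsto_nhds_unique (hG.continuousAt.tendsto.comp hcoe)
      ((tendsto_smul_resY h0 h1 h hA hf).congr' ?_)
    filter_upwards [hcoe.eventually hGe, self_mem_nhdsWithin] with x hx hx0
    exact (hx (by simpa using (ne_of_gt hx0))).symm
  obtain ⟨p, hp⟩ := hG
  -- Because `G 0 = 0`, the difference quotient at the origin is `G z / z`.
  refine ⟨dslope G 0, hp.has_fpower_series_dslope_fslope.analyticAt, ?_⟩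
  filter_upwards [hGe] with z hz hre
  have hz0 : z ≠ 0 := by rintro rfl; simp at hre
  rw [dslope_of_ne _ hz0, slope_def_module, hG0, hz hre, sub_zero, sub_zero, smul_smul,
    inv_mul_cancel₀ hz0, one_smul]

/-! ### Removing the singularities where `e ^ z = c` -/

theorem eventually_cexp_ne (z₀ : ℂ) (c : ℂ) : ∀ᶠ z in 𝓝[≠] z₀, cexp z ≠ c :=
  (Complex.hasDerivAt_exp z₀).eventually_ne (Complex.exp_ne_zero _)

theorem eq_I_mul_im {z : ℂ} (hz : z.re = 0) : z = I * (z.im : ℂ) := by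
  apply Complex.ext <;> simp [hz]

theorem extendsAt_of_cexp_ne (h0 : 0 < α) (h1 : α ≤ 1) {c : ℂ} (hA : ∀ z ∈ SigmaI A α, cexp z = c)
    (hf : ∀ ξ ∈ sp f, cexp (I * ξ) = c) (h : IsAsymptoticMildSolution A α f u) {z : ℂ}
    (hz : cexp z ≠ c) : ExtendsAt (fun z => resY X z (cls X u)) z := by
  have hres : ∀ ξ : ℝ, cexp (I * ξ) ≠ c → I * (ξ : ℂ) ∈ fracResolventSet A α := by
    intro ξ hξ
    by_contra hn
    exact hξ (hA _ ⟨⟨ξ, rfl⟩, hn⟩)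
  have key : ∀ z : ℂ, z ≠ 0 → cexp z ≠ c → ExtendsAt (fun z => resY X z (cls X u)) z := by
    intro z hz0 hz
    by_cases hre : z.re = 0
    · have e := eq_I_mul_im hre
      rw [e] at hz ⊢
      refine extendsAt_of_mild h0 h1 h (fun h => hz0 ?_) (hres _ hz) fun hn => hz (hf _ hn)
      rw [e, h]
      simp
    · exact extendsAt_resY_of_re_ne_zero hre _
  rcases eq_or_ne z 0 with rfl | hz0
  · have hz' : cexp (I * ((0 : ℝ) : ℂ)) ≠ c := by simpa using hz
    have hr := hres 0 hz'
    rw [ofReal_zero, mul_zero] at hr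
    refine extendsAt_zero_of_mild h0 h1 h hr (fun hn => hz' (hf _ hn)) ?_
    filter_upwards [self_mem_nhdsWithin, eventually_cexp_ne 0 c] with z h1 h2
    exact key z h1 h2
  · exact key z hz0 hz

/-- Treats both periodicity types at once. Applying `S - c` cancels the singularities at the
isolated points with `e ^ z = c`, and the Liouville argument then kills the class of `u(· + 1) - c
u`. -/
theorem isAsymptoticBloch_of_mild (h0 : 0 < α) (h1 : α ≤ 1) {p : ℝ}
    (hA : ∀ z ∈ SigmaI A α, cexp z = cexp (I * p)) (hf : ∀ ξ ∈ sp f, cexp (I * ξ) = cexp (I * p))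
    (h : IsAsymptoticMildSolution A α f u) : IsAsymptoticBloch p u := by
  set c := cexp (I * p) with hc
  set y := shiftSub X c (cls X u) with hy
  have hne : ∀ z, cexp z ≠ c → ExtendsAt (fun z => resY X z y) z := by
    intro z hz
    obtain ⟨G, hG, hGe⟩ := (extendsAt_of_cexp_ne h0 h1 hA hf h hz).clm (shiftSub X c)
    exact ⟨G, hG, hGe.mono fun w hw hre => (hw hre).trans (resY_shiftSub hre c _).symm⟩
  have hall : ∀ z, ExtendsAt (fun z => resY X z y) z := by
    intro z
    by_cases hre : z.re = 0
    · by_cases hz : cexp z = c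
      · obtain ⟨K, hK⟩ := (Complex.hasDerivAt_exp z).isBigO_sub.bound
        refine ExtendsAt.of_isolated hre
          (C := max K 0 * ‖u‖ + Real.exp (‖z‖ + 1) * ‖u‖) (by positivity)
          ((eventually_cexp_ne z c).mono hne) ?_
        filter_upwards [hK, Metric.ball_mem_nhds z one_pos] with w hw hwb hwre
        rw [Metric.mem_ball, dist_eq_norm] at hwb
        have hp : 0 < |w.re| := abs_pos.2 hwre
        -- As `z` lies on the axis, `|re w| ≤ |w - z|`; this absorbs the bounded term into the
        -- Levinson-type bound.
        have h2 : 1 ≤ ‖w - z‖ / |w.re| := by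
          rw [one_le_div hp]
          simpa [hre] using Complex.abs_re_le_norm (w - z)
        have h3 : ‖w‖ ≤ ‖z‖ + 1 := by
          have := norm_sub_norm_le w z
          linarith
        have h4 : ‖cexp w - c‖ ≤ max K 0 * ‖w - z‖ := by
          rw [hz] at hw
          exact hw.trans (by gcongr; exact le_max_left _ _)
        calc _ ≤ ‖cexp w - c‖ * (‖u‖ / |w.re|) + Real.exp ‖w‖ * ‖u‖ :=
              norm_resY_shiftSub_le hwre c u
          _ ≤ max K 0 * ‖w - z‖ * (‖u‖ / |w.re|)
              + Real.exp (‖z‖ + 1) * ‖u‖ * (‖w - z‖ / |w.re|) := by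
              refine add_le_add (by gcongr) ?_
              calc Real.exp ‖w‖ * ‖u‖ ≤ Real.exp (‖z‖ + 1) * ‖u‖ * 1 := by
                    rw [mul_one]; gcongr
                _ ≤ _ := by gcongr
          _ = _ := by ring
      · exact hne z hz
    · exact extendsAt_resY_of_re_ne_zero hre y
  have h1re : (1 : ℂ).re ≠ 0 := by simp
  have h2 := eq_zero_of_extendsAt (norm_nonneg y) hall (fun z _ => norm_resY_apply_le z y) h1re
  have h3 := eq_zero_of_resY_eq_zero h1re h2
  rw [hy, shiftSub_cls, cls_eq_zero_iff, mem_C0] at h3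
  exact h3

end

end FracAsymp

/-! ### The periodic and anti-periodic cases -/

theorem mainTheorem1 {X : Type*} [NormedAddCommGroup X] [NormedSpace ℂ X] [CompleteSpace X]
    (A : X →ₗ.[ℂ] X) (α : ℝ) (hα0 : 0 < α) (hα1 : α ≤ 1) (f : FracAsymp.BUC X) :
    ((∀ z ∈ FracAsymp.SigmaI A α, ∃ k : ℤ, z = 2 * (k : ℂ) * (Real.pi : ℂ) * Complex.I) →
      (∀ ξ ∈ FracAsymp.sp f, ∃ k : ℤ, ξ = 2 * (k : ℝ) * Real.pi) →
      ∀ u : FracAsymp.BUC X, FracAsymp.IsAsymptoticMildSolution A α f u →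
        FracAsymp.IsAsymptoticPeriodic u) ∧
    ((∀ z ∈ FracAsymp.SigmaI A α, ∃ k : ℤ, z = (2 * (k : ℂ) + 1) * (Real.pi : ℂ) * Complex.I) →
      (∀ ξ ∈ FracAsymp.sp f, ∃ k : ℤ, ξ = (2 * (k : ℝ) + 1) * Real.pi) →
      ∀ u : FracAsymp.BUC X, FracAsymp.IsAsymptoticMildSolution A α f u →
        FracAsymp.IsAsymptoticAntiPeriodic u) := by
  have hper : ∀ k : ℤ, Complex.exp (2 * (k : ℂ) * (Real.pi : ℂ) * Complex.I)
      = Complex.exp (Complex.I * (0 : ℝ)) := by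
    intro k
    rw [Complex.ofReal_zero, mul_zero, Complex.exp_zero, Complex.exp_eq_one_iff]
    exact ⟨k, by ring⟩
  have hanti : ∀ k : ℤ, Complex.exp ((2 * (k : ℂ) + 1) * (Real.pi : ℂ) * Complex.I)
      = Complex.exp (Complex.I * Real.pi) := by
    intro k
    rw [Complex.exp_eq_exp_iff_exists_int]
    exact ⟨k, by ring⟩
  refine ⟨fun hA hf u hu => ?_, fun hA hf u hu => ?_⟩
  · refine FracAsymp.isAsymptoticBloch_of_mild hα0 hα1 (p := 0) (fun z hz => ?_) (fun ξ hξ => ?_) hu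
    · obtain ⟨k, rfl⟩ := hA z hz
      exact hper k
    · obtain ⟨k, rfl⟩ := hf ξ hξ
      rw [← hper k]
      congr 1
      push_cast
      ring
  · refine FracAsymp.isAsymptoticBloch_of_mild hα0 hα1 (p := Real.pi) (fun z hz => ?_)
      (fun ξ hξ => ?_) hu
    · obtain ⟨k, rfl⟩ := hA z hz
      exact hanti k
    · obtain ⟨k, rfl⟩ := hf ξ hξ
      rw [← hanti k]
      congr 1
      push_cast
      ring
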